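/- **Theorem 3.1.** Let $T$ be a hyperbolic automorphism of the torus $\mathbb T^2=\mathbb R^2/\mathbb Z^2$ given by a matrix $M=\begin{pmatrix}a&b\\c&d\end{pmatrix}\in GL(2,\mathbb Z)$ (no eigenvalue of $M$ has modulus $1$) with trace $r=a+d>0$ and determinant $\sigma=\pm1$. Put $D=r^2-4\sigma$, $\lambda=\frac{r+\sqrt D}{2}$ and $f_T(x,y)=bx^2-(a-d)xy-cy^2$. Let $\mathfrak X$ be the following set of two-sided sequences $\varepsilon=(\varepsilon_n)_{n\in\mathbb Z}$ of non-negative integers. If $\sigma=-1$: $\varepsilon_n\le r$ for all $n$, and $\varepsilon_n=r$ implies $\varepsilon_{n+1}=0$. If $\sigma=+1$: $\varepsilon_n\le r-1$ for all $n$, and no block $(r-1)(r-2)^j(r-1)$ with $j\ge0$ occurs. For $(u,v)\in\mathbb Z^2$ let $$\begin{pmatrix}n\\k\end{pmatrix}=-\sigma M\begin{pmatrix}v\\u\end{pmatrix},\qquad \mathbf t=\mathbf t(u,v)=\left(\frac{v+n\lambda}{\sqrt D},\frac{u+k\lambda}{\sqrt D}\right)\bmod\mathbb Z^2 .$$ Then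 $\mathbf t$ is homoclinic to zero, i.e. $T^m\mathbf t\to\mathbf 0$ as $m\to\pm\infty$; the limit $$\varphi_{\mathbf t}(\varepsilon)=\lim_{N\to\infty}\sum_{n=-N}^{N}\varepsilon_nT^{-n}\mathbf t$$ exists in $\mathbb T^2$ for every $\varepsilon\in\mathfrak X$; and the arithmetic coding $\varphi_{\mathbf t}:\mathfrak X\to\mathbb T^2$ is $K$-to-$1$ almost everywhere with $$K=K(u,v)=|f_T(u,-v)|,$$ i.e. for Lebesgue almost every $x\in\mathbb T^2$ there are exactly $K$ sequences $\varepsilon\in\mathfrak X$ with $\varphi_{\mathbf t}(\varepsilon)=x$. -/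

import Mathlib

open Filter Topology MeasureTheory

noncomputable section

namespace ToralCoding

/-- The two-dimensional torus `ℝ² / ℤ²`, written as `(ℝ / ℤ)²`. Its `volume` is the normalized
Lebesgue (Haar) measure. -/
abbrev Torus : Type := Fin 2 → UnitAddCircle

/-- Reduction of a point of the plane modulo `ℤ²`. -/
def toTorus (x : Fin 2 → ℝ) : Torus := fun i => (x i : UnitAddCircle)

/-- The endomorphism `x ↦ M x` of the torus given by an integral matrix `M`; it is an automorphism
for `M ∈ GL(2, ℤ)`. -/
def act (M : GL (Fin 2) ℤ) : Torus →+ Torus where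
  toFun x := fun i => ∑ j, M.val i j • x j
  map_zero' := by
    funext i
    simp
  map_add' x y := by
    funext i
    simp [smul_add, Finset.sum_add_distrib]

/-- The automorphism given by `M` is hyperbolic: no eigenvalue of `M` has modulus one. -/
def IsHyperbolic (M : GL (Fin 2) ℤ) : Prop :=
  ∀ z ∈ spectrum ℂ (M.val.map (Int.cast : ℤ → ℂ)), ‖z‖ ≠ 1

/-- The discriminant `D = r² - 4σ` of the characteristic polynomial `x² - r x + σ`. -/
def discrim (M : GL (Fin 2) ℤ) : ℤ := M.val.trace ^ 2 - 4 * M.val.det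

/-- The eigenvalue `(r + √D) / 2`. -/
def eigenvalue (M : GL (Fin 2) ℤ) : ℝ :=
  ((M.val.trace : ℝ) + Real.sqrt (discrim M : ℝ)) / 2

/-- The quadratic form `b x² - (a - d) x y - c y²` associated with the matrix `(a, b; c, d)`. -/
def assocForm (M : GL (Fin 2) ℤ) (x y : ℤ) : ℤ :=
  M.val 0 1 * x ^ 2 - (M.val 0 0 - M.val 1 1) * x * y - M.val 1 0 * y ^ 2

/-- A point of the torus is homoclinic (to zero) if `Tⁿ t → 0` as `n → ±∞`. -/
def IsHomoclinic (M : GL (Fin 2) ℤ) (t : Torus) : Prop :=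
  Tendsto (fun n : ℤ => act (M ^ n) t) atTop (𝓝 0) ∧
    Tendsto (fun n : ℤ => act (M ^ n) t) atBot (𝓝 0)

/-- The integral vector `(n, k) = - det M • M (v, u)`. -/
def latticeVector (M : GL (Fin 2) ℤ) (u v : ℤ) : Fin 2 → ℤ :=
  (-M.val.det) • M.val.mulVec ![v, u]

/-- The point of the torus with planar coordinates `((v + n λ) / √D, (u + k λ) / √D)`, where
`(n, k)` is the lattice vector above and `λ` is the eigenvalue above. -/
def homoclinicPoint (M : GL (Fin 2) ℤ) (u v : ℤ) : Torus :=
  toTorus ![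
    ((v : ℝ) + (latticeVector M u v 0 : ℝ) * eigenvalue M) / Real.sqrt (discrim M : ℝ),
    ((u : ℝ) + (latticeVector M u v 1 : ℝ) * eigenvalue M) / Real.sqrt (discrim M : ℝ)]

/-- The Markov compactum: digits `0, …, r`, and a digit `r` is followed by `0`. -/
def markovCompactum (r : ℤ) : Set (ℤ → ℕ) :=
  {e | (∀ n, (e n : ℤ) ≤ r) ∧ ∀ n, (e n : ℤ) = r → e (n + 1) = 0}

/-- The sofic compactum: digits `0, …, r - 1`, and no block of the form
`(r - 1) (r - 2) … (r - 2) (r - 1)`, with any number (possibly zero) of digits `r - 2` between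
the two digits `r - 1`. -/
def soficCompactum (r : ℤ) : Set (ℤ → ℕ) :=
  {e | (∀ n, (e n : ℤ) ≤ r - 1) ∧
    ∀ m n, m < n →
      ¬ ((e m : ℤ) = r - 1 ∧ (∀ i, m < i → i < n → (e i : ℤ) = r - 2) ∧ (e n : ℤ) = r - 1)}

/-- The symbolic compactum of `M`: the Markov one for `det M = -1`, the sofic one for
`det M = 1`. -/
def compactum (M : GL (Fin 2) ℤ) : Set (ℤ → ℕ) :=
  {e | (M.val.det = -1 → e ∈ markovCompactum M.val.trace) ∧
    (M.val.det = 1 → e ∈ soficCompactum M.val.trace)}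

/-- The symmetric partial sum from `-N` to `N` of the series of `e n • T⁻ⁿ t`. -/
def partialSum (M : GL (Fin 2) ℤ) (t : Torus) (e : ℤ → ℕ) (N : ℕ) : Torus :=
  ∑ n ∈ Finset.Icc (-(N : ℤ)) (N : ℤ), e n • act (M ^ (-n)) t

/-- The arithmetic coding with parameter `t`: the limit of the symmetric partial sums. -/
def coding (M : GL (Fin 2) ℤ) (t : Torus) (e : ℤ → ℕ) : Torus :=
  limUnder atTop (partialSum M t e)

end ToralCoding

end

noncomputable section

namespace ToralCoding

/-! ### Contraction -/

/-! Let `l` and `m` be the eigenvalues of `M`, `q` the vector `latticeVector M u v`, and use the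
eigencoordinates of `planeMap`, in which (1, 1) goes to `q`, (l, m) goes to Mq, and M acts as
diag(l, m). Then **t** is the image of (1, 0). Since (1, 1) goes to an integer vector, **t** is also
the image of (0, -1). The first form shows decay of the orbit in backward time, the second in
forward time. Summing with the first form for n ≥ 0 and the second for n < 0 shows that the coding
of e is the image of the point (`future l e 0`, `past m e 0`).

The theorem becomes a statement about the plane: these points should represent almost every coset of
the lattice Λ spanned by (1, 1) and (l, m) exactly once. Indeed Λ goes onto ℤq + ℤMq, of index
|det(q, Mq)| = |f_T(u, -v)| in ℤ². A generic torus point therefore lifts to exactly that many cosets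
of Λ (`encard_fibre`). If the determinant vanishes, the image of the plane is null and almost every
fibre is empty (`ae_notMem_range`).

For the coset statement, `IsTile` asks for a bounded set R that contains all code points, meets
every coset of Λ, meets each generic coset once, and is preserved at generic points by removing the
integer part d = ⌊x⌋, (x, y) ↦ (l(x - d), m(y - d)), with admissible digits. Two L-shaped sets of
area l - m, the covolume of Λ, do this: `isTile_markov` and `isTile_sofic`. They cover by an
exchange of two intervals. The points excluded as non-generic form a null set (`ae_isGeneric`). -/

theorem nonpos_of_contraction {ι : Type*} {f : ι → ℝ} {C a : ℝ} (hC : ∀ n, f n ≤ C)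
    (ha0 : 0 ≤ a) (ha1 : a < 1)
    (h : ∀ B, 0 ≤ B → (∀ n, f n ≤ B) → ∀ n, f n ≤ a * B) (n : ι) : f n ≤ 0 := by
  -- Boundedness starts the iteration: each pass improves the bound by the factor `a`, so the bounds
  -- tend to 0.
  have key : ∀ k : ℕ, ∀ n, f n ≤ a ^ k * max C 0 := by
    intro k
    induction k with
    | zero => intro n; simpa using Or.inl (hC n)
    | succ k ih =>
      intro n
      have := h _ (by positivity) ih n
      rwa [← mul_assoc, ← pow_succ'] at this
  have hlim : Tendsto (fun k : ℕ => a ^ k * max C 0) atTop (𝓝 (0 * max C 0)) :=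
    (tendsto_pow_atTop_nhds_zero_of_lt_one ha0 ha1).mul_const _
  rw [zero_mul] at hlim
  exact ge_of_tendsto' hlim fun k => key k n

/-! ### Digit series -/

theorem summable_digits {a : ℝ} (ha : |a| < 1) {f : ℕ → ℕ} {B : ℕ} (hf : ∀ k, f k ≤ B) :
    Summable fun k => (f k : ℝ) * a ^ k := by
  refine Summable.of_norm_bounded (g := fun k => (B : ℝ) * |a| ^ k)
    ((summable_geometric_of_lt_one (abs_nonneg a) ha).mul_left _) fun k => ?_
  rw [norm_mul, norm_pow, Real.norm_eq_abs, Real.norm_eq_abs, Nat.abs_cast]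
  gcongr
  exact hf k

theorem abs_tsum_digits_le {a : ℝ} (ha : |a| < 1) {f : ℕ → ℕ} {B : ℕ} (hf : ∀ k, f k ≤ B) :
    |∑' k, (f k : ℝ) * a ^ k| ≤ B * (1 - |a|)⁻¹ := by
  rw [← Real.norm_eq_abs]
  refine tsum_of_norm_bounded (g := fun k => (B : ℝ) * |a| ^ k)
    ((hasSum_geometric_of_lt_one (abs_nonneg a) ha).mul_left _) fun k => ?_
  rw [norm_mul, norm_pow, Real.norm_eq_abs, Real.norm_eq_abs, Nat.abs_cast]
  gcongr
  exact hf k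

/-- The number `e n + e (n + 1) / l + e (n + 2) / l² + …`. -/
def future (l : ℝ) (e : ℤ → ℕ) (n : ℤ) : ℝ := ∑' k : ℕ, (e (n + k) : ℝ) * l⁻¹ ^ k

/-- The number `-(e (n - 1) m + e (n - 2) m² + …)`. -/
def past (m : ℝ) (e : ℤ → ℕ) (n : ℤ) : ℝ := -(m * ∑' k : ℕ, (e (n - 1 - k) : ℝ) * m ^ k)

section Series

variable {l m : ℝ} {e : ℤ → ℕ} {B : ℕ}

theorem abs_inv_lt_one (hl : 1 < l) : |l⁻¹| < 1 := by
  rw [abs_of_pos (by positivity)]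
  exact inv_lt_one_of_one_lt₀ hl

theorem future_eq (hl : 1 < l) (he : ∀ n, e n ≤ B) (n : ℤ) :
    future l e n = e n + l⁻¹ * future l e (n + 1) := by
  unfold future
  rw [(summable_digits (abs_inv_lt_one hl) fun k => he (n + (k : ℕ))).tsum_eq_zero_add,
    ← tsum_mul_left]
  simp only [Nat.cast_zero, add_zero, pow_zero, mul_one, add_right_inj]
  refine tsum_congr fun k => ?_
  rw [show n + ((k + 1 : ℕ) : ℤ) = n + 1 + k by push_cast; ring, pow_succ]
  ring

theorem future_succ (hl : 1 < l) (he : ∀ n, e n ≤ B) (n : ℤ) :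
    future l e (n + 1) = l * (future l e n - e n) := by
  rw [future_eq hl he n]
  have : l ≠ 0 := by positivity
  field_simp
  ring

theorem past_succ (hm : |m| < 1) (he : ∀ n, e n ≤ B) (n : ℤ) :
    past m e (n + 1) = m * (past m e n - e n) := by
  unfold past
  rw [(summable_digits hm fun k => he (n + 1 - 1 - (k : ℕ))).tsum_eq_zero_add]
  have : ∀ k : ℕ, (e (n + 1 - 1 - ((k + 1 : ℕ) : ℤ)) : ℝ) * m ^ (k + 1)
      = m * ((e (n - 1 - k) : ℝ) * m ^ k) := fun k => by
    rw [show n + 1 - 1 - ((k + 1 : ℕ) : ℤ) = n - 1 - k by push_cast; ring, pow_succ]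
    ring
  simp only [this, tsum_mul_left]
  simp
  ring

theorem abs_future_le (hl : 1 < l) (he : ∀ n, e n ≤ B) (n : ℤ) :
    |future l e n| ≤ B * (1 - |l⁻¹|)⁻¹ :=
  abs_tsum_digits_le (abs_inv_lt_one hl) fun k => he (n + (k : ℕ))

theorem abs_past_le (hm : |m| < 1) (he : ∀ n, e n ≤ B) (n : ℤ) :
    |past m e n| ≤ B * (1 - |m|)⁻¹ := by
  unfold past
  rw [abs_neg, abs_mul]
  refine (mul_le_of_le_one_left (abs_nonneg _) hm.le).trans ?_
  exact abs_tsum_digits_le hm fun k => he (n - 1 - (k : ℕ))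

theorem future_nonneg (hl : 1 < l) (n : ℤ) : 0 ≤ future l e n :=
  tsum_nonneg fun _ => by positivity

end Series

/-! ### The lattice of a quadratic unit -/

/-- `l` and `m` are the roots of `x² - r x + s`, where `s = ±1`, and `|m| < 1 < l`. -/
structure IsUnitPair (r s : ℤ) (l m : ℝ) : Prop where
  sign : s = 1 ∨ s = -1
  add : l + m = r
  mul : l * m = s
  one_lt : 1 < l
  abs_lt : |m| < 1

/-- The module `ℤ + ℤ l`. -/
def InModule (l a : ℝ) : Prop := ∃ i j : ℤ, a = i + j * l

/-- The lattice spanned by `(1, 1)` and `(l, m)`. -/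
def InLattice (l m a b : ℝ) : Prop := ∃ i j : ℤ, a = i + j * l ∧ b = i + j * m

/-- Points with coordinates outside `ℤ + ℤ l` and `ℤ + ℤ m`. -/
def IsGeneric (l m : ℝ) (p : ℝ × ℝ) : Prop := ¬ InModule l p.1 ∧ ¬ InModule m p.2

/-- The map removing the digit `d`. -/
def shiftMap (l m : ℝ) (d : ℕ) (p : ℝ × ℝ) : ℝ × ℝ := (l * (p.1 - d), m * (p.2 - d))

section Lattice

variable {l m a b a' b' : ℝ} {r s : ℤ}

theorem InLattice.inModule (h : InLattice l m a b) : InModule l a ∧ InModule m b := by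
  obtain ⟨i, j, rfl, rfl⟩ := h
  exact ⟨⟨i, j, rfl⟩, ⟨i, j, rfl⟩⟩

theorem InModule.add (h : InModule l a) (h' : InModule l b) : InModule l (a + b) := by
  obtain ⟨i, j, rfl⟩ := h
  obtain ⟨i', j', rfl⟩ := h'
  exact ⟨i + i', j + j', by push_cast; ring⟩

theorem InModule.neg (h : InModule l a) : InModule l (-a) := by
  obtain ⟨i, j, rfl⟩ := h
  exact ⟨-i, -j, by push_cast; ring⟩

theorem InLattice.add (h : InLattice l m a b) (h' : InLattice l m a' b') :
    InLattice l m (a + a') (b + b') := by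
  obtain ⟨i, j, rfl, rfl⟩ := h
  obtain ⟨i', j', rfl, rfl⟩ := h'
  exact ⟨i + i', j + j', by push_cast; ring, by push_cast; ring⟩

theorem InLattice.neg (h : InLattice l m a b) : InLattice l m (-a) (-b) := by
  obtain ⟨i, j, rfl, rfl⟩ := h
  exact ⟨-i, -j, by push_cast; ring, by push_cast; ring⟩

theorem inLattice_natCast (d : ℕ) : InLattice l m d d := ⟨d, 0, by simp, by simp⟩

theorem InLattice.sub (h : InLattice l m a b) (h' : InLattice l m a' b') :
    InLattice l m (a - a') (b - b') := by
  simpa [sub_eq_add_neg] using h.add h'.neg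

namespace IsUnitPair

theorem sign_sq (h : IsUnitPair r s l m) : (s : ℝ) * s = 1 := by
  rcases h.sign with rfl | rfl <;> norm_num

theorem left_ne_zero (h : IsUnitPair r s l m) : l ≠ 0 := by
  have := h.one_lt
  positivity

theorem right_ne_zero (h : IsUnitPair r s l m) : m ≠ 0 := by
  rintro rfl
  have h1 := h.sign_sq
  rw [← h.mul] at h1
  simp at h1

theorem inv_left (h : IsUnitPair r s l m) : l⁻¹ = s * m := by
  rw [inv_eq_iff_eq_inv, eq_comm, inv_eq_iff_eq_inv, ← one_div, eq_div_iff h.left_ne_zero]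
  linear_combination (s : ℝ) * h.mul + h.sign_sq

theorem inv_right (h : IsUnitPair r s l m) : m⁻¹ = s * l := by
  rw [inv_eq_iff_eq_inv, eq_comm, inv_eq_iff_eq_inv, ← one_div, eq_div_iff h.right_ne_zero]
  linear_combination (s : ℝ) * h.mul + h.sign_sq

theorem sq_left (h : IsUnitPair r s l m) : l * l = r * l - s := by
  linear_combination l * h.add - h.mul

theorem sq_right (h : IsUnitPair r s l m) : m * m = r * m - s := by
  linear_combination m * h.add - h.mul

/-- The lattice is the ring ℤ[l] embedded by its two conjugations, so it is stable under
multiplication by `l`; as the norm s is ±1, it is stable under the inverse too. -/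
theorem inLattice_mul (h : IsUnitPair r s l m) (hab : InLattice l m a b) :
    InLattice l m (l * a) (m * b) := by
  obtain ⟨i, j, rfl, rfl⟩ := hab
  refine ⟨-(s * j), i + r * j, ?_, ?_⟩ <;> push_cast
  · linear_combination (j : ℝ) * h.sq_left
  · linear_combination (j : ℝ) * h.sq_right

theorem inLattice_inv_mul (h : IsUnitPair r s l m) (hab : InLattice l m a b) :
    InLattice l m (l⁻¹ * a) (m⁻¹ * b) := by
  obtain ⟨i, j, rfl, rfl⟩ := hab
  refine ⟨j + s * r * i, -(s * i), ?_, ?_⟩ <;> push_cast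
  · rw [mul_add, mul_comm (j : ℝ) l, inv_mul_cancel_left₀ h.left_ne_zero, h.inv_left]
    linear_combination (s * i : ℝ) * h.add
  · rw [mul_add, mul_comm (j : ℝ) m, inv_mul_cancel_left₀ h.right_ne_zero, h.inv_right]
    linear_combination (s * i : ℝ) * h.add

theorem inLattice_zpow_mul (h : IsUnitPair r s l m) (hab : InLattice l m a b) (n : ℤ) :
    InLattice l m (l ^ n * a) (m ^ n * b) := by
  induction n with
  | zero => simpa using hab
  | succ k ih =>
    rw [zpow_add_one₀ h.left_ne_zero, zpow_add_one₀ h.right_ne_zero, mul_comm _ l, mul_comm _ m,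
      mul_assoc, mul_assoc]
    exact h.inLattice_mul ih
  | pred k ih =>
    rw [zpow_sub_one₀ h.left_ne_zero, zpow_sub_one₀ h.right_ne_zero, mul_comm _ l⁻¹,
      mul_comm _ m⁻¹, mul_assoc, mul_assoc]
    exact h.inLattice_inv_mul ih

theorem inModule_zpow_mul_left (h : IsUnitPair r s l m) (ha : InModule l a) (n : ℤ) :
    InModule l (l ^ n * a) := by
  obtain ⟨i, j, rfl⟩ := ha
  exact (h.inLattice_zpow_mul ⟨i, j, rfl, rfl⟩ n).inModule.1

theorem inModule_zpow_mul_right (h : IsUnitPair r s l m) (hb : InModule m b) (n : ℤ) :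
    InModule m (m ^ n * b) := by
  obtain ⟨i, j, rfl⟩ := hb
  exact (h.inLattice_zpow_mul ⟨i, j, rfl, rfl⟩ n).inModule.2

theorem isGeneric_zpow_mul (h : IsUnitPair r s l m) (hab : IsGeneric l m (a, b)) (n : ℤ) :
    IsGeneric l m (l ^ n * a, m ^ n * b) := by
  refine ⟨fun hc => hab.1 ?_, fun hc => hab.2 ?_⟩
  · have := h.inModule_zpow_mul_left hc (-n)
    rwa [← mul_assoc, ← zpow_add₀ h.left_ne_zero, neg_add_cancel, zpow_zero, one_mul] at this
  · have := h.inModule_zpow_mul_right hc (-n)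
    rwa [← mul_assoc, ← zpow_add₀ h.right_ne_zero, neg_add_cancel, zpow_zero, one_mul] at this

end IsUnitPair

theorem IsGeneric.of_inLattice {p p' : ℝ × ℝ} (hp : IsGeneric l m p)
    (h : InLattice l m (p'.1 - p.1) (p'.2 - p.2)) : IsGeneric l m p' := by
  refine ⟨fun hc => hp.1 ?_, fun hc => hp.2 ?_⟩
  · simpa using hc.add h.inModule.1.neg
  · simpa using hc.add h.inModule.2.neg

end Lattice

/-! ### Tiles carrying a symbolic system -/

/-- `R` is a tile for the lattice of `l` and `m`, on which the map removing the integer part is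
coded by the symbolic system `X`. -/
structure IsTile (l m : ℝ) (R : Set (ℝ × ℝ)) (X : Set (ℤ → ℕ)) : Prop where
  bounded : ∃ C, ∀ p ∈ R, |p.1| ≤ C ∧ |p.2| ≤ C
  cover : ∀ a b, ∃ p ∈ R, InLattice l m (p.1 - a) (p.2 - b)
  unique : ∀ p ∈ R, ∀ p' ∈ R, IsGeneric l m p → IsGeneric l m p' →
    InLattice l m (p'.1 - p.1) (p'.2 - p.2) → p' = p
  digits : ∃ B, ∀ e ∈ X, ∀ n, e n ≤ B
  mem : ∀ e ∈ X, ∀ n, (future l e n, past m e n) ∈ R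
  step : ∀ p ∈ R, IsGeneric l m p → shiftMap l m ⌊p.1⌋₊ p ∈ R
  admissible : ∀ p : ℤ → ℝ × ℝ, (∀ n, p n ∈ R) → (∀ n, IsGeneric l m (p n)) →
    (∀ n, p (n + 1) = shiftMap l m ⌊(p n).1⌋₊ (p n)) → (fun n => ⌊(p n).1⌋₊) ∈ X

section Tile

variable {l m a b : ℝ} {r s : ℤ} {R : Set (ℝ × ℝ)} {X : Set (ℤ → ℕ)}

theorem eq_zero_of_expanding {u : ℤ → ℝ} {C : ℝ} (hl : 1 < l) (hC : ∀ n, |u n| ≤ C)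
    (h : ∀ n, u (n + 1) = l * u n) (n : ℤ) : u n = 0 := by
  refine abs_nonpos_iff.1 (nonpos_of_contraction hC (inv_nonneg.2 (by positivity))
    (inv_lt_one_of_one_lt₀ hl) (fun B _ hB n => ?_) n)
  have h1 := hB (n + 1)
  rw [h, abs_mul, abs_of_pos (by positivity : 0 < l)] at h1
  rwa [inv_mul_eq_div, le_div_iff₀' (by positivity)]

theorem eq_zero_of_contracting {u : ℤ → ℝ} {C : ℝ} (hm : |m| < 1) (hC : ∀ n, |u n| ≤ C)
    (h : ∀ n, u (n + 1) = m * u n) (n : ℤ) : u n = 0 := by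
  refine abs_nonpos_iff.1 (nonpos_of_contraction hC (abs_nonneg m) hm (fun B _ hB n => ?_) n)
  have h1 := h (n - 1)
  rw [sub_add_cancel] at h1
  rw [h1, abs_mul]
  exact mul_le_mul_of_nonneg_left (hB _) (abs_nonneg m)

/-- A digit d contributes the lattice vector (d, d), so modulo the lattice removing digits is just
multiplication by (l, m). -/
theorem inLattice_shift (h : IsUnitPair r s l m) {e : ℤ → ℕ} {p : ℤ → ℝ × ℝ}
    (hp : ∀ n, p (n + 1) = shiftMap l m (e n) (p n))
    (h0 : InLattice l m ((p 0).1 - a) ((p 0).2 - b)) (n : ℤ) :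
    InLattice l m ((p n).1 - l ^ n * a) ((p n).2 - m ^ n * b) := by
  induction n with
  | zero => simpa using h0
  | succ k ih =>
    have h1 := h.inLattice_mul (ih.sub (inLattice_natCast (e k)))
    rw [hp, zpow_add_one₀ h.left_ne_zero, zpow_add_one₀ h.right_ne_zero]
    simp only [shiftMap]
    convert h1 using 1 <;> ring
  | pred k ih =>
    have h2 := hp (-(k : ℤ) - 1)
    rw [sub_add_cancel] at h2
    have h1 := (h.inLattice_inv_mul ih).add (inLattice_natCast (e (-(k : ℤ) - 1)))
    rw [h2] at h1
    simp only [shiftMap] at h1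
    rw [zpow_sub_one₀ h.left_ne_zero, zpow_sub_one₀ h.right_ne_zero]
    have hl := h.left_ne_zero
    have hm := h.right_ne_zero
    convert h1 using 1 <;> field_simp <;> ring

/-- The point of the plane with the given digits, seen from time `n`. -/
def codePoint (l m : ℝ) (e : ℤ → ℕ) (n : ℤ) : ℝ × ℝ := (future l e n, past m e n)

theorem codePoint_succ (h : IsUnitPair r s l m) {e : ℤ → ℕ} {B : ℕ} (he : ∀ n, e n ≤ B) (n : ℤ) :
    codePoint l m e (n + 1) = shiftMap l m (e n) (codePoint l m e n) := by
  simp only [codePoint, shiftMap, future_succ h.one_lt he, past_succ h.abs_lt he]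

/-! ### Existence and uniqueness of codes over a tile -/

namespace IsTile

theorem exists_code (h : IsUnitPair r s l m) (hT : IsTile l m R X)
    (hab : IsGeneric l m (a, b)) :
    ∃ e ∈ X, InLattice l m (future l e 0 - a) (past m e 0 - b) := by
  choose p hpR hpL using fun n : ℤ => hT.cover (l ^ n * a) (m ^ n * b)
  have hg : ∀ n, IsGeneric l m (p n) := fun n =>
    (h.isGeneric_zpow_mul hab n).of_inLattice (hpL n)
  -- The shifted representative of the coset at time n lies in the tile and in the coset at time n +
  -- 1, so by uniqueness it is the representative chosen there.
  have hstep : ∀ n, p (n + 1) = shiftMap l m ⌊(p n).1⌋₊ (p n) := by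
    intro n
    have h1 : InLattice l m ((shiftMap l m ⌊(p n).1⌋₊ (p n)).1 - l ^ (n + 1) * a)
        ((shiftMap l m ⌊(p n).1⌋₊ (p n)).2 - m ^ (n + 1) * b) := by
      have := h.inLattice_mul ((hpL n).sub (inLattice_natCast ⌊(p n).1⌋₊))
      rw [zpow_add_one₀ h.left_ne_zero, zpow_add_one₀ h.right_ne_zero]
      simp only [shiftMap]
      convert this using 1 <;> ring
    refine hT.unique _ (hT.step _ (hpR n) (hg n)) _ (hpR _)
      ((h.isGeneric_zpow_mul hab (n + 1)).of_inLattice h1) (hg _) ?_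
    simpa using (hpL (n + 1)).sub h1
  have heX := hT.admissible p hpR hg hstep
  set e : ℤ → ℕ := fun n => ⌊(p n).1⌋₊
  have hstep' : ∀ n, p (n + 1) = shiftMap l m (e n) (p n) := hstep
  obtain ⟨B, hB⟩ := hT.digits
  obtain ⟨C, hC⟩ := hT.bounded
  -- The difference between code point and `p` is bounded on all of ℤ and is multiplied by `l`,
  -- respectively `m`, at each step; so it vanishes.
  have hx : future l e 0 - (p 0).1 = 0 := by
    refine eq_zero_of_expanding (u := fun n => future l e n - (p n).1) (C := C + C) h.one_lt
      (fun n => ?_) (fun n => ?_) 0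
    · exact (abs_sub _ _).trans (add_le_add (hC _ (hT.mem e heX n)).1 (hC _ (hpR n)).1)
    · simp only [future_succ h.one_lt (hB e heX), hstep' n, shiftMap]
      ring
  have hy : past m e 0 - (p 0).2 = 0 := by
    refine eq_zero_of_contracting (u := fun n => past m e n - (p n).2) (C := C + C) h.abs_lt
      (fun n => ?_) (fun n => ?_) 0
    · exact (abs_sub _ _).trans (add_le_add (hC _ (hT.mem e heX n)).2 (hC _ (hpR n)).2)
    · simp only [past_succ h.abs_lt (hB e heX), hstep' n, shiftMap]
      ring
  refine ⟨e, heX, ?_⟩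
  rw [sub_eq_zero.1 hx, sub_eq_zero.1 hy]
  simpa using hpL 0

/-- At every time both code points lie in the tile and in the same generic coset, hence coincide; a
digit is recovered from two consecutive values of `future`. -/
theorem code_unique (h : IsUnitPair r s l m) (hT : IsTile l m R X)
    (hab : IsGeneric l m (a, b)) {e e' : ℤ → ℕ} (he : e ∈ X) (he' : e' ∈ X)
    (hL : InLattice l m (future l e 0 - a) (past m e 0 - b))
    (hL' : InLattice l m (future l e' 0 - a) (past m e' 0 - b)) : e = e' := by
  obtain ⟨B, hB⟩ := hT.digits
  have key : ∀ n, future l e n = future l e' n := by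
    intro n
    have h1 := inLattice_shift h (p := codePoint l m e) (codePoint_succ h (hB e he)) hL n
    have h2 := inLattice_shift h (p := codePoint l m e') (codePoint_succ h (hB e' he')) hL' n
    have hg := h.isGeneric_zpow_mul hab n
    have := hT.unique _ (hT.mem e' he' n) _ (hT.mem e he n) (hg.of_inLattice h2)
      (hg.of_inLattice h1) (by simpa [codePoint] using h1.sub h2)
    exact congrArg Prod.fst this
  funext n
  have h1 := future_eq h.one_lt (hB e he) n
  have h2 := future_eq h.one_lt (hB e' he') n
  rw [key n, key (n + 1)] at h1
  exact_mod_cast add_right_cancel (h1.symm.trans h2)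

end IsTile

end Tile

section

/-- The `L`-shaped tile for determinant `-1`. -/
def markovTile (l m : ℝ) : Set (ℝ × ℝ) :=
  {p | 0 ≤ p.1 ∧ p.1 ≤ l ∧ m ≤ p.2 ∧ p.2 ≤ 1 ∧ (p.1 ≤ 1 ∨ p.2 ≤ 1 + m)}

/-- The `L`-shaped tile for determinant `1`. -/
def soficTile (l m : ℝ) : Set (ℝ × ℝ) :=
  {p | 0 ≤ p.1 ∧ p.1 ≤ l ∧ -1 ≤ p.2 ∧ p.2 ≤ 0 ∧ (p.1 ≤ l - 1 ∨ m - 1 ≤ p.2)}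

variable {l m : ℝ} {r : ℤ}

/-! ### Covering by an exchange of two intervals -/

/-- If `F` raises the height by at least `c > 0` at each point of `S` and has a
right inverse, then some point of `S` crosses the height `h`. -/
theorem exists_crossing {α : Type*} {S : Set α} {F G : α → α} {y : α → ℝ} {c : ℝ} (hc : 0 < c)
    (hF : ∀ p ∈ S, F p ∈ S) (hG : ∀ p ∈ S, G p ∈ S) (hFG : ∀ p ∈ S, F (G p) = p)
    (hy : ∀ p ∈ S, y p + c ≤ y (F p)) {p : α} (hp : p ∈ S) (h : ℝ) :
    ∃ p' ∈ S, y p' < h ∧ h ≤ y (F p') := by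
  have up : ∀ k : ℕ, ∀ p ∈ S, y p < h → h ≤ y p + k * c → ∃ p' ∈ S, y p' < h ∧ h ≤ y (F p') := by
    intro k
    induction k with
    | zero =>
      intro p _ h1 h2
      simp at h2
      linarith
    | succ k ih =>
      intro p hp h1 h2
      by_cases h3 : h ≤ y (F p)
      · exact ⟨p, hp, h1, h3⟩
      · refine ih (F p) (hF p hp) (not_le.1 h3) ?_
        have := hy p hp
        push_cast at h2
        linarith
  have down : ∀ k : ℕ, ∀ p ∈ S, h ≤ y p → y p - k * c < h →
      ∃ p' ∈ S, y p' < h ∧ h ≤ y (F p') := by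
    intro k
    induction k with
    | zero =>
      intro p _ h1 h2
      simp at h2
      linarith
    | succ k ih =>
      intro p hp h1 h2
      by_cases h3 : y (G p) < h
      · exact ⟨G p, hG p hp, h3, by rwa [hFG p hp]⟩
      · refine ih (G p) (hG p hp) (not_lt.1 h3) ?_
        have := hy _ (hG p hp)
        rw [hFG p hp] at this
        push_cast at h2
        linarith
  rcases lt_or_ge (y p) h with h1 | h1
  · obtain ⟨k, hk⟩ := exists_nat_ge ((h - y p) / c)
    exact up k p hp h1 (by rw [div_le_iff₀ hc] at hk; linarith)
  · obtain ⟨k, hk⟩ := exists_nat_gt ((y p - h) / c)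
    exact down k p hp h1 (by rw [div_lt_iff₀ hc] at hk; linarith)

theorem exists_inLattice_strip (hl : 0 < l) (a b : ℝ) :
    ∃ p : ℝ × ℝ, (0 ≤ p.1 ∧ p.1 < l) ∧ InLattice l m (p.1 - a) (p.2 - b) := by
  refine ⟨(a - ⌊a / l⌋ * l, b - ⌊a / l⌋ * m), ⟨?_, ?_⟩, 0, -⌊a / l⌋, ?_, ?_⟩
  · have := Int.floor_le (a / l)
    rw [le_div_iff₀ hl] at this
    simpa using this
  · have := Int.lt_floor_add_one (a / l)
    rw [div_lt_iff₀ hl] at this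
    simp only
    linarith
  · push_cast; ring
  · push_cast; ring

/-- In every coset of the lattice, the exchange of the intervals `[1, l)` and `[0, 1)`, with lattice
steps `(-1, -d)` and `(l - 1, -i)`, crosses the height `h`. -/
theorem exists_inLattice_exchange {i c d : ℝ} (hl : 1 < l) (hc : 0 < c)
    (hi : InLattice l m (-1) (-d)) (hj : InLattice l m (l - 1) (-i)) (hci : c ≤ i) (hcd : c ≤ d)
    (a b h : ℝ) :
    ∃ x y : ℝ, InLattice l m (x - a) (y - b) ∧ h < y ∧
      ((1 ≤ x ∧ x < l ∧ y - d ≤ h) ∨ (0 ≤ x ∧ x < 1 ∧ y - i ≤ h)) := by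
  obtain ⟨p, hp, hpL⟩ := exists_inLattice_strip (m := m) (by positivity : 0 < l) a b
  -- Both steps of the exchange lower the second coordinate by at least `c`, so its negative serves
  -- as the height; `q` is the last point of its orbit above `h`.
  obtain ⟨q, ⟨⟨hq0, hq1⟩, hqL⟩, h1, h2⟩ := exists_crossing
    (S := {p : ℝ × ℝ | (0 ≤ p.1 ∧ p.1 < l) ∧ InLattice l m (p.1 - a) (p.2 - b)})
    (F := fun p => if 1 ≤ p.1 then (p.1 - 1, p.2 - d) else (p.1 + (l - 1), p.2 - i))
    (G := fun p => if p.1 < l - 1 then (p.1 + 1, p.2 + d) else (p.1 - (l - 1), p.2 + i))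
    (y := fun p => -p.2) hc
    (by
      rintro p ⟨⟨h1, h2⟩, h3⟩
      split_ifs with h4
      · refine ⟨⟨by simpa using h4, by simp only; linarith⟩, ?_⟩
        convert h3.add hi using 1 <;> simp only <;> ring
      · refine ⟨⟨by simp only; linarith, by simp only; linarith⟩, ?_⟩
        convert h3.add hj using 1 <;> simp only <;> ring)
    (by
      rintro p ⟨⟨h1, h2⟩, h3⟩
      split_ifs with h4
      · refine ⟨⟨by simp only; linarith, by simp only; linarith⟩, ?_⟩
        convert h3.sub hi using 1 <;> simp only <;> ring
      · refine ⟨⟨by simp only; linarith, by simp only; linarith⟩, ?_⟩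
        convert h3.sub hj using 1 <;> simp only <;> ring)
    (by
      rintro ⟨x, y⟩ ⟨⟨h1, h2⟩, h3⟩
      by_cases h4 : x < l - 1
      · simp only [if_pos h4]
        rw [if_pos (by simpa using h1)]
        simp
      · simp only [if_neg h4]
        rw [if_neg (by simp only at h2; linarith)]
        simp)
    (by
      rintro p ⟨⟨h1, h2⟩, h3⟩
      split_ifs <;> linarith) ⟨hp, hpL⟩ (-h)
  refine ⟨q.1, q.2, hqL, by linarith, ?_⟩
  split_ifs at h2 with h3
  · exact Or.inl ⟨h3, hq1, by simp only at h2; linarith⟩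
  · exact Or.inr ⟨hq0, not_le.1 h3, by simp only at h2; linarith⟩

/-! ### Determinant `-1` -/

theorem IsGeneric.ne_left {p : ℝ × ℝ} (h : IsGeneric l m p) (i j : ℤ) : p.1 ≠ i + j * l :=
  fun hc => h.1 ⟨i, j, hc⟩

theorem IsGeneric.ne_right {p : ℝ × ℝ} (h : IsGeneric l m p) (i j : ℤ) : p.2 ≠ i + j * m :=
  fun hc => h.2 ⟨i, j, hc⟩

theorem markovTile_interior {p : ℝ × ℝ} (hp : p ∈ markovTile l m) (hg : IsGeneric l m p) :
    0 < p.1 ∧ p.1 < l ∧ m < p.2 ∧ p.2 < 1 ∧ (p.1 < 1 ∨ p.2 < 1 + m) := by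
  obtain ⟨h1, h2, h3, h4, h5⟩ := hp
  refine ⟨lt_of_le_of_ne h1 ?_, lt_of_le_of_ne h2 ?_, lt_of_le_of_ne h3 ?_, lt_of_le_of_ne h4 ?_,
    h5.imp (fun h => lt_of_le_of_ne h ?_) (fun h => lt_of_le_of_ne h ?_)⟩
  · simpa using (hg.ne_left 0 0).symm
  · simpa using hg.ne_left 0 1
  · simpa using (hg.ne_right 0 1).symm
  · simpa using hg.ne_right 1 0
  · simpa using hg.ne_left 1 0
  · simpa using hg.ne_right 1 1

theorem soficTile_interior {p : ℝ × ℝ} (hp : p ∈ soficTile l m) (hg : IsGeneric l m p) :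
    0 < p.1 ∧ p.1 < l ∧ -1 < p.2 ∧ p.2 < 0 ∧ (p.1 < l - 1 ∨ m - 1 < p.2) := by
  obtain ⟨h1, h2, h3, h4, h5⟩ := hp
  refine ⟨lt_of_le_of_ne h1 ?_, lt_of_le_of_ne h2 ?_, lt_of_le_of_ne h3 ?_, lt_of_le_of_ne h4 ?_,
    h5.imp (fun h => lt_of_le_of_ne h ?_) (fun h => lt_of_le_of_ne h ?_)⟩
  · simpa using (hg.ne_left 0 0).symm
  · simpa using hg.ne_left 0 1
  · simpa using (hg.ne_right (-1) 0).symm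
  · simpa using hg.ne_right 0 0
  · simpa [neg_add_eq_sub] using hg.ne_left (-1) 1
  · simpa [neg_add_eq_sub] using (hg.ne_right (-1) 1).symm

/-- To prove that a lattice vector vanishes it is enough to exclude one of each pair of
opposite vectors. -/
theorem eq_of_inLattice {p p' : ℝ × ℝ} {Q : ℝ × ℝ → Prop} (hp : Q p) (hp' : Q p')
    (hQ : ∀ p p' : ℝ × ℝ, Q p → Q p' → ∀ i j : ℤ, p'.1 - p.1 = i + j * l →
      p'.2 - p.2 = i + j * m → ¬ (0 < j ∨ j = 0 ∧ 0 < i))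
    (h : InLattice l m (p'.1 - p.1) (p'.2 - p.2)) : p' = p := by
  obtain ⟨i, j, h1, h2⟩ := h
  have h3 := hQ p p' hp hp' i j h1 h2
  have h4 := hQ p' p hp' hp (-i) (-j) (by push_cast; linarith) (by push_cast; linarith)
  have hj : j = 0 := by omega
  have hi : i = 0 := by omega
  subst hj hi
  simp only [Int.cast_zero, zero_mul, add_zero, sub_eq_zero] at h1 h2
  exact Prod.ext h1 h2

/-- The bounding box has sides l and 1 - m, which excludes every translation except (1, 1); that one
would land in the removed corner. -/
theorem markovTile_unique (h : IsUnitPair r (-1) l m) {p p' : ℝ × ℝ}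
    (hp : p ∈ markovTile l m) (hp' : p' ∈ markovTile l m) (hg : IsGeneric l m p)
    (hg' : IsGeneric l m p') (hL : InLattice l m (p'.1 - p.1) (p'.2 - p.2)) : p' = p := by
  have hl := h.one_lt
  have hml := h.mul
  have hm := (abs_lt.1 h.abs_lt).1
  push_cast at hml
  have hm0 : m < 0 := by nlinarith
  refine eq_of_inLattice (Q := fun p => p ∈ markovTile l m ∧ IsGeneric l m p)
    ⟨hp, hg⟩ ⟨hp', hg'⟩ ?_ hL
  rintro p p' ⟨hp, hg⟩ ⟨hp', hg'⟩ i j h1 h2 hij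
  obtain ⟨a1, a2, a3, a4, a5⟩ := markovTile_interior hp hg
  obtain ⟨b1, b2, b3, b4, b5⟩ := markovTile_interior hp' hg'
  rcases hij with hj | ⟨rfl, hi⟩
  · have hj' : (1 : ℝ) ≤ j := by exact_mod_cast hj
    rcases le_or_gt 0 i with hi | hi
    · have hi' : (0 : ℝ) ≤ i := by exact_mod_cast hi
      nlinarith
    · have hi' : (i : ℝ) ≤ -1 := by exact_mod_cast Int.le_sub_one_of_lt hi
      nlinarith
  · simp only [Int.cast_zero, zero_mul, add_zero] at h1 h2
    rcases (show i = 1 ∨ 2 ≤ i by omega) with rfl | hi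
    · push_cast at h1 h2
      rcases b5 with b5 | b5 <;> linarith
    · have hi' : (2 : ℝ) ≤ i := by exact_mod_cast hi
      linarith

theorem natCast_cases (d : ℕ) (k : ℤ) (h : (d : ℤ) ≤ k) : (d : ℝ) = k ∨ (d : ℝ) ≤ k - 1 := by
  rcases h.eq_or_lt with h | h
  · left; exact_mod_cast h
  · right; exact_mod_cast Int.le_sub_one_of_lt h

/-- Removing the digit r sends the right end x = l to l(l - r) = -lm = 1; so after a digit r the
point has x < 1 and the next digit is 0. -/
theorem markovTile_step (h : IsUnitPair r (-1) l m) {p : ℝ × ℝ}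
    (hp : p ∈ markovTile l m) (hg : IsGeneric l m p) :
    (⌊p.1⌋₊ : ℤ) ≤ r ∧ ((⌊p.1⌋₊ : ℤ) = r → l * (p.1 - ⌊p.1⌋₊) < 1) ∧
    shiftMap l m ⌊p.1⌋₊ p ∈ markovTile l m := by
  have hl := h.one_lt
  have hml := h.mul
  have hm := (abs_lt.1 h.abs_lt).1
  have hadd := h.add
  push_cast at hml
  have hm0 : m < 0 := by nlinarith
  obtain ⟨a1, a2, a3, a4, a5⟩ := markovTile_interior hp hg
  have f1 := Nat.floor_le a1.le
  have f2 := Nat.lt_floor_add_one p.1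
  set d := ⌊p.1⌋₊
  have hd : (d : ℤ) ≤ r := by
    have : (d : ℝ) < r + 1 := by linarith
    have : (d : ℤ) < r + 1 := by exact_mod_cast this
    omega
  have hd0 : (0 : ℝ) ≤ d := by positivity
  have hr : (d : ℝ) = r → l * (p.1 - d) < 1 := fun hdr => by nlinarith
  refine ⟨hd, fun hdr => hr (by exact_mod_cast hdr), ?_, ?_, ?_, ?_, ?_⟩ <;> simp only [shiftMap]
  · exact mul_nonneg (by linarith) (by linarith)
  · nlinarith
  · nlinarith
  · rcases natCast_cases d r hd with hdr | hdr <;> nlinarith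
  · rcases natCast_cases d r hd with hdr | hdr
    · exact Or.inl (hr hdr).le
    · right
      nlinarith

theorem code_mem_markovTile (h : IsUnitPair r (-1) l m) {e : ℤ → ℕ}
    (he : e ∈ markovCompactum r) (n : ℤ) : (future l e n, past m e n) ∈ markovTile l m := by
  have hl := h.one_lt
  have hml := h.mul
  have hm := (abs_lt.1 h.abs_lt).1
  have hadd := h.add
  have hinv : l⁻¹ = -m := by rw [h.inv_left]; push_cast; ring
  push_cast at hml
  have hm0 : m < 0 := by nlinarith
  have hr0 : (1 : ℝ) ≤ r := by
    have : (0 : ℝ) < r := by linarith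
    exact_mod_cast this
  have hB : ∀ n, e n ≤ r.toNat := fun n => by have := he.1 n; omega
  have fx := future_eq hl hB
  have fy := past_succ h.abs_lt hB
  rw [hinv] at fx
  have hx : ∀ n, future l e n - l ≤ 0 := by
    refine nonpos_of_contraction (a := -m) (C := r.toNat * (1 - |l⁻¹|)⁻¹ - l) (fun n => ?_)
      (by linarith) (by linarith) fun B hB0 hB' n => ?_
    · linarith [(abs_le.1 (abs_future_le hl hB n)).2]
    · have h1 := fx n
      have h2 := hB' (n + 1)
      rcases natCast_cases (e n) r (he.1 n) with hn | hn
      -- The next digit is 0, so two steps are expanded: r + l⁻²(l + B) = l + l⁻²B.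
      · have h3 := he.2 n (by exact_mod_cast hn)
        have h4 := fx (n + 1)
        have h5 := hB' (n + 1 + 1)
        rw [h3] at h4
        push_cast at h4
        nlinarith
      · nlinarith
  have hy : ∀ n, max (past m e n - 1) (m - past m e n) ≤ 0 := by
    refine nonpos_of_contraction (a := -m) (C := r.toNat * (1 - |m|)⁻¹ + 1) (fun n => ?_)
      (by linarith) (by linarith) fun B hB0 hB' n => ?_
    · have := abs_le.1 (abs_past_le h.abs_lt hB n)
      exact max_le (by linarith) (by linarith)
    · have h1 := fy (n - 1)
      rw [sub_add_cancel] at h1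
      have h2 := max_le_iff.1 (hB' (n - 1))
      have h3 : (e (n - 1) : ℝ) ≤ r := by exact_mod_cast he.1 (n - 1)
      have h4 : (0 : ℝ) ≤ e (n - 1) := by positivity
      rw [h1]
      refine max_le ?_ ?_ <;> nlinarith
  have hy1 := fun n => (max_le_iff.1 (hy n)).1
  have hy2 := fun n => (max_le_iff.1 (hy n)).2
  refine ⟨future_nonneg hl n, by linarith [hx n], by simpa using hy2 n, by simpa using hy1 n, ?_⟩
  simp only
  have h1 := fy (n - 1)
  rw [sub_add_cancel] at h1
  -- The removed corner is avoided: a previous digit r forces the present digit 0, hence x ≤ l⁻¹l =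
  -- 1, while a smaller previous digit gives y ≤ 1 + m.
  rcases natCast_cases (e (n - 1)) r (he.1 (n - 1)) with hn | hn
  · left
    have h3 := he.2 (n - 1) (by exact_mod_cast hn)
    rw [sub_add_cancel] at h3
    rw [fx n, h3]
    push_cast
    nlinarith [hx (n + 1)]
  · right
    nlinarith [hy2 (n - 1)]

theorem isTile_markov (h : IsUnitPair r (-1) l m) :
    IsTile l m (markovTile l m) (markovCompactum r) := by
  have hl := h.one_lt
  have hm := (abs_lt.1 h.abs_lt).1
  have hml := h.mul
  push_cast at hml
  have hm0 : m < 0 := by nlinarith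
  refine ⟨⟨l, ?_⟩, fun a b => ?_, fun p hp p' hp' => markovTile_unique h hp hp',
    ⟨r.toNat, fun e he n => ?_⟩, fun e he n => code_mem_markovTile h he n,
    fun p hp hg => (markovTile_step h hp hg).2.2, fun p hp hg hS => ⟨fun n => ?_, fun n hn => ?_⟩⟩
  · rintro p ⟨h1, h2, h3, h4, -⟩
    exact ⟨abs_le.2 ⟨by linarith, h2⟩, abs_le.2 ⟨by linarith, by linarith⟩⟩
  -- Crossing height m with drops 1 and 1 - m leaves y in (m, 1 + m] over [1, l) and in (m, 1] over
  -- [0, 1), which is the L.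
  · obtain ⟨x, y, hL, hy, hxy⟩ := exists_inLattice_exchange (m := m) (i := 1 - m) hl one_pos
      ⟨-1, 0, by simp, by simp⟩ ⟨-1, 1, by push_cast; ring, by push_cast; ring⟩ (by linarith) le_rfl
      a b m
    refine ⟨(x, y), ?_, hL⟩
    rcases hxy with ⟨h1, h2, h3⟩ | ⟨h1, h2, h3⟩
    · exact ⟨by simp only; linarith, h2.le, hy.le, by simp only; linarith,
        Or.inr (by simp only; linarith)⟩
    · exact ⟨h1, by simp only; linarith, hy.le, by simp only; linarith, Or.inl h2.le⟩
  · have := he.1 n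
    omega
  · exact (markovTile_step h (hp n) (hg n)).1
  · have := (markovTile_step h (hp n) (hg n)).2.1 hn
    exact Nat.floor_eq_zero.2 (by rw [hS n]; exact this)

/-! ### Determinant `1` -/

theorem IsUnitPair.two_lt (h : IsUnitPair r 1 l m) (hr : 3 ≤ r) : 0 < m ∧ 2 < l := by
  have hl := h.one_lt
  have hml := h.mul
  have hm := (_root_.abs_lt.1 h.abs_lt).2
  have hadd := h.add
  push_cast at hml
  have hr' : (3 : ℝ) ≤ r := by exact_mod_cast hr
  exact ⟨by nlinarith, by linarith⟩

/-- The bounding box has sides l and 1, which excludes every translation except (l - 1, m - 1); that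
one would land in the removed corner. -/
theorem soficTile_unique (h : IsUnitPair r 1 l m) (hr : 3 ≤ r) {p p' : ℝ × ℝ}
    (hp : p ∈ soficTile l m) (hp' : p' ∈ soficTile l m) (hg : IsGeneric l m p)
    (hg' : IsGeneric l m p') (hL : InLattice l m (p'.1 - p.1) (p'.2 - p.2)) : p' = p := by
  obtain ⟨hm0, hl⟩ := h.two_lt hr
  have hml := h.mul
  push_cast at hml
  have hm : m < 1 / 2 := by nlinarith
  refine eq_of_inLattice (Q := fun p => p ∈ soficTile l m ∧ IsGeneric l m p)
    ⟨hp, hg⟩ ⟨hp', hg'⟩ ?_ hL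
  rintro p p' ⟨hp, hg⟩ ⟨hp', hg'⟩ i j h1 h2 hij
  obtain ⟨a1, a2, a3, a4, a5⟩ := soficTile_interior hp hg
  obtain ⟨b1, b2, b3, b4, b5⟩ := soficTile_interior hp' hg'
  rcases hij with hj | ⟨rfl, hi⟩
  · rcases (show j = 1 ∨ 2 ≤ j by omega) with rfl | hj
    · push_cast at h1 h2
      rcases (show 0 ≤ i ∨ i = -1 ∨ i ≤ -2 by omega) with hi | rfl | hi
      · have hi' : (0 : ℝ) ≤ i := by exact_mod_cast hi
        linarith
      · push_cast at h1 h2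
        rcases b5 with b5 | b5 <;> linarith
      · have hi' : (i : ℝ) ≤ -2 := by exact_mod_cast hi
        linarith
    · have hj' : (2 : ℝ) ≤ j := by exact_mod_cast hj
      nlinarith
  · simp only [Int.cast_zero, zero_mul, add_zero] at h1 h2
    have hi' : (1 : ℝ) ≤ i := by exact_mod_cast hi
    linarith

/-- The threshold l - 1 is fixed by removing the digit r - 2, and removing r - 1 sends x = l to it.
So x < l - 1 holds after a digit r - 1 and persists through digits r - 2. -/
theorem soficTile_step (h : IsUnitPair r 1 l m) (hr : 3 ≤ r) {p : ℝ × ℝ}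
    (hp : p ∈ soficTile l m) (hg : IsGeneric l m p) :
    (⌊p.1⌋₊ : ℤ) ≤ r - 1 ∧ ((⌊p.1⌋₊ : ℤ) = r - 1 → l * (p.1 - ⌊p.1⌋₊) < l - 1) ∧
    ((⌊p.1⌋₊ : ℤ) = r - 2 → p.1 < l - 1 → l * (p.1 - ⌊p.1⌋₊) < l - 1) ∧
    shiftMap l m ⌊p.1⌋₊ p ∈ soficTile l m := by
  obtain ⟨hm0, hl⟩ := h.two_lt hr
  have hml := h.mul
  have hadd := h.add
  push_cast at hml
  have hm : m < 1 / 2 := by nlinarith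
  obtain ⟨a1, a2, a3, a4, a5⟩ := soficTile_interior hp hg
  have f1 := Nat.floor_le a1.le
  have f2 := Nat.lt_floor_add_one p.1
  set d := ⌊p.1⌋₊
  have hd : (d : ℤ) ≤ r - 1 := by
    have : (d : ℝ) < r := by linarith
    have : (d : ℤ) < r := by exact_mod_cast this
    omega
  have hd0 : (0 : ℝ) ≤ d := by positivity
  have hr1 : (d : ℝ) = r - 1 → l * (p.1 - d) < l - 1 := fun hdr => by nlinarith
  have hr2 : (d : ℝ) = r - 2 → p.1 < l - 1 → l * (p.1 - d) < l - 1 := fun hdr _ => by nlinarith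
  have hd' : (d : ℝ) = r - 1 ∨ (d : ℝ) = r - 2 ∨ (d : ℝ) ≤ r - 3 := by
    rcases (show (d : ℤ) = r - 1 ∨ (d : ℤ) = r - 2 ∨ (d : ℤ) ≤ r - 3 by omega) with h | h | h
    · left; exact_mod_cast h
    · right; left; exact_mod_cast h
    · right; right; exact_mod_cast h
  refine ⟨hd, fun hdr => hr1 (by exact_mod_cast hdr), fun hdr => hr2 (by exact_mod_cast hdr),
    ?_, ?_, ?_, ?_, ?_⟩ <;> simp only [shiftMap]
  · exact mul_nonneg (by linarith) (by linarith)
  · nlinarith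
  · rcases hd' with hdr | hdr | hdr
    · rcases a5 with a5 | a5
      · linarith
      · nlinarith
    · nlinarith
    · nlinarith
  · nlinarith
  · rcases hd' with hdr | hdr | hdr
    · exact Or.inl (hr1 hdr).le
    · rcases a5 with a5 | a5
      · exact Or.inl (hr2 hdr a5).le
      · right
        nlinarith
    · right
      nlinarith

/-- The digits from `n` on start with `(r - 2) … (r - 2) (r - 1)`. -/
def IsLarge (r : ℤ) (e : ℤ → ℕ) (n : ℤ) : Prop :=
  ∃ k, n ≤ k ∧ (∀ i, n ≤ i → i < k → (e i : ℤ) = r - 2) ∧ (e k : ℤ) = r - 1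

/-- The bound l or l - 1, according to `IsLarge`, is compatible with the recursion for `future`:
after a digit r - 1 the tail is not large, and r - 1 + m(l - 1) = l, while r - 2 + m(l - 1) = l - 1.
The excess over the bound thus contracts by m. -/
theorem future_le_sofic (h : IsUnitPair r 1 l m) (hr : 3 ≤ r) {e : ℤ → ℕ}
    (he : e ∈ soficCompactum r) (n : ℤ) :
    future l e n ≤ l ∧ (¬ IsLarge r e n → future l e n ≤ l - 1) := by
  classical
  obtain ⟨hm0, hl⟩ := h.two_lt hr
  have hml := h.mul
  have hadd := h.add
  have hinv : l⁻¹ = m := by rw [h.inv_left]; push_cast; ring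
  push_cast at hml
  have hm : m < 1 / 2 := by nlinarith
  have hB : ∀ n, e n ≤ r.toNat := fun n => by have := he.1 n; omega
  have fx := future_eq h.one_lt hB
  rw [hinv] at fx
  have key : ∀ n, future l e n - (if IsLarge r e n then l else l - 1) ≤ 0 := by
    refine nonpos_of_contraction (a := m) (C := r.toNat * (1 - |l⁻¹|)⁻¹) (fun n => ?_)
      hm0.le (by linarith) fun B hB0 hB' n => ?_
    · have := (abs_le.1 (abs_future_le h.one_lt hB n)).2
      split_ifs <;> linarith
    · have h1 := fx n
      have h2 := hB' (n + 1)
      have h3 : future l e (n + 1) ≤ l + B := by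
        split_ifs at h2 <;> linarith
      rcases (show (e n : ℤ) = r - 1 ∨ (e n : ℤ) = r - 2 ∨ (e n : ℤ) ≤ r - 3 by
        have := he.1 n; omega) with hn | hn | hn
      · have hn' : (e n : ℝ) = r - 1 := by exact_mod_cast hn
        have h4 : ¬ IsLarge r e (n + 1) := by
          rintro ⟨k, hk, hk1, hk2⟩
          exact he.2 n k (by omega) ⟨hn, fun i hi hi' => hk1 i (by omega) hi', hk2⟩
        rw [if_neg h4] at h2
        rw [if_pos ⟨n, le_rfl, fun i _ _ => by omega, hn⟩]
        nlinarith
      · have hn' : (e n : ℝ) = r - 2 := by exact_mod_cast hn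
        by_cases h4 : IsLarge r e (n + 1)
        · rw [if_pos]
          · nlinarith
          · obtain ⟨k, hk, hk1, hk2⟩ := h4
            refine ⟨k, by omega, fun i hi hi' => ?_, hk2⟩
            rcases hi.eq_or_lt with rfl | hi
            · exact hn
            · exact hk1 i (by omega) hi'
        · rw [if_neg h4] at h2
          split_ifs <;> nlinarith
      · have hn' : (e n : ℝ) ≤ r - 3 := by exact_mod_cast hn
        split_ifs <;> nlinarith
  have h1 := key n
  refine ⟨?_, fun h2 => ?_⟩
  · split_ifs at h1 <;> linarith
  · rw [if_neg h2] at h1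
    linarith

theorem reverse_mem_soficCompactum {e : ℤ → ℕ} (he : e ∈ soficCompactum r) :
    (fun n => e (-n)) ∈ soficCompactum r := by
  refine ⟨fun n => he.1 _, fun i j hij => ?_⟩
  rintro ⟨h1, h2, h3⟩
  refine he.2 (-j) (-i) (by omega) ⟨h3, fun k hk hk' => ?_, h1⟩
  simpa using h2 (-k) (by omega) (by omega)

/-- Here m = l⁻¹, and the sofic system is invariant under reversal, so bounds on `future` transfer
to `past`. -/
theorem past_eq_reverse (h : IsUnitPair r 1 l m) (e : ℤ → ℕ) (n : ℤ) :
    past m e n = -(m * future l (fun i => e (-i)) (1 - n)) := by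
  have hinv : l⁻¹ = m := by rw [h.inv_left]; push_cast; ring
  unfold past future
  rw [hinv]
  congr 2
  refine tsum_congr fun k => ?_
  simp only [show -(1 - n + (k : ℤ)) = n - 1 - k by ring]

theorem code_mem_soficTile (h : IsUnitPair r 1 l m) (hr : 3 ≤ r) {e : ℤ → ℕ}
    (he : e ∈ soficCompactum r) (n : ℤ) : (future l e n, past m e n) ∈ soficTile l m := by
  obtain ⟨hm0, hl⟩ := h.two_lt hr
  have hml := h.mul
  push_cast at hml
  have hx := future_le_sofic h hr he n
  have hy := future_le_sofic h hr (reverse_mem_soficCompactum he) (1 - n)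
  have hy0 := future_nonneg (e := fun i => e (-i)) h.one_lt (1 - n)
  -- Both being large would put a forbidden block across the boundary between times n - 1 and n.
  have hlarge : ¬ IsLarge r e n ∨ ¬ IsLarge r (fun i => e (-i)) (1 - n) := by
    rw [← not_and_or]
    rintro ⟨⟨k, hk, hk1, hk2⟩, ⟨k', hk', hk1', hk2'⟩⟩
    refine he.2 (-k') k (by omega) ⟨hk2', fun i hi hi' => ?_, hk2⟩
    rcases le_or_gt n i with h1 | h1
    · exact hk1 i h1 hi'
    · simpa using hk1' (-i) (by omega) (by omega)
  refine ⟨future_nonneg h.one_lt n, hx.1, ?_, ?_, ?_⟩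
  · simp only [past_eq_reverse h]
    nlinarith
  · simp only [past_eq_reverse h]
    nlinarith
  · simp only [past_eq_reverse h]
    rcases hlarge with h1 | h1
    · exact Or.inl (hx.2 h1)
    · right
      nlinarith [hy.2 h1]

theorem isTile_sofic (h : IsUnitPair r 1 l m) (hr : 3 ≤ r) :
    IsTile l m (soficTile l m) (soficCompactum r) := by
  obtain ⟨hm0, hl⟩ := h.two_lt hr
  have hadd := h.add
  have hm := (abs_lt.1 h.abs_lt).2
  refine ⟨⟨l, ?_⟩, fun a b => ?_, fun p hp p' hp' => soficTile_unique h hr hp hp',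
    ⟨r.toNat, fun e he n => ?_⟩, fun e he n => code_mem_soficTile h hr he n,
    fun p hp hg => (soficTile_step h hr hp hg).2.2.2,
    fun p hp hg hS => ⟨fun n => ?_, fun i j hij => ?_⟩⟩
  · rintro p ⟨h1, h2, h3, h4, -⟩
    exact ⟨abs_le.2 ⟨by linarith, h2⟩, abs_le.2 ⟨by linarith, by linarith⟩⟩
  · have v1 : InLattice l m (-1) (-1) := ⟨-1, 0, by simp, by simp⟩
    have v2 : InLattice l m (l - 1) (-(1 - m)) := ⟨-1, 1, by push_cast; ring, by push_cast; ring⟩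
    -- Here the tile consists of the points just after crossing height 0, so one more exchange step
    -- is applied to the crossing point.
    obtain ⟨x, y, hL, hy, hxy⟩ := exists_inLattice_exchange (c := 1 - m) h.one_lt (by linarith)
      v1 v2 le_rfl (by linarith) a b 0
    rcases hxy with ⟨h1, h2, h3⟩ | ⟨h1, h2, h3⟩
    · refine ⟨(x - 1, y - 1), ⟨by simp only; linarith, by simp only; linarith,
        by simp only; linarith, h3, Or.inl (by simp only; linarith)⟩, ?_⟩
      convert hL.add v1 using 1 <;> ring
    · refine ⟨(x + (l - 1), y - (1 - m)), ⟨by simp only; linarith, by simp only; linarith,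
        by simp only; linarith, h3, Or.inr (by simp only; linarith)⟩, ?_⟩
      convert hL.add v2 using 1 <;> ring
  · have := he.1 n
    omega
  · exact (soficTile_step h hr (hp n) (hg n)).1
  · rintro ⟨h1, h2, h3⟩
    -- After the first r - 1 the point stays left of l - 1 = r - 1 - m, where the digit r - 1 is
    -- impossible.
    have key : ∀ k : ℕ, i + 1 + k ≤ j → (p (i + 1 + k)).1 < l - 1 := by
      intro k
      induction k with
      | zero =>
        intro _
        simpa [hS i, shiftMap] using (soficTile_step h hr (hp i) (hg i)).2.1 h1
      | succ k ih =>
        intro hk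
        push_cast at hk ⊢
        rw [← add_assoc, hS (i + 1 + k)]
        exact (soficTile_step h hr (hp _) (hg _)).2.2.1 (h2 _ (by omega) (by omega))
          (ih (by omega))
    have h4 := key (j - (i + 1)).toNat (by omega)
    rw [show i + 1 + ((j - (i + 1)).toNat : ℤ) = j by omega] at h4
    have h5 := Nat.floor_le (hp j).1
    have h6 : (⌊(p j).1⌋₊ : ℝ) = r - 1 := by exact_mod_cast h3
    linarith

end

/-! ### Eigenvalues of hyperbolic matrices -/

theorem det_eq_or (M : GL (Fin 2) ℤ) : M.val.det = 1 ∨ M.val.det = -1 :=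
  Int.isUnit_iff.1 ((Matrix.isUnit_iff_isUnit_det _).1 M.isUnit)

theorem mem_spectrum_map_iff (M : GL (Fin 2) ℤ) (z : ℂ) :
    z ∈ spectrum ℂ (M.val.map (Int.cast : ℤ → ℂ)) ↔
      z ^ 2 - M.val.trace * z + M.val.det = 0 := by
  rw [Matrix.mem_spectrum_iff_isRoot_charpoly, Matrix.charpoly_fin_two, Polynomial.IsRoot.def]
  simp [Matrix.trace_fin_two, Matrix.det_fin_two]

theorem IsHyperbolic.three_le_trace {M : GL (Fin 2) ℤ} (hM : IsHyperbolic M)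
    (hr : 0 < M.val.trace) (hdet : M.val.det = 1) : 3 ≤ M.val.trace := by
  by_contra hlt
  rcases (show M.val.trace = 1 ∨ M.val.trace = 2 by omega) with h | h
  -- Trace 1 gives a primitive sixth root of unity; trace 2 gives the eigenvalue 1.
  · refine hM ⟨1 / 2, √3 / 2⟩ ((mem_spectrum_map_iff M _).2 ?_) ?_
    · rw [h, hdet]
      have h3 : √(3 : ℝ) * √3 = 3 := Real.mul_self_sqrt (by norm_num)
      apply Complex.ext
      · simp [pow_two]
        linarith
      · simp [pow_two]
        ring
    · have h3 : √(3 : ℝ) * √3 = 3 := Real.mul_self_sqrt (by norm_num)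
      rw [Complex.norm_def, Complex.normSq_mk, Real.sqrt_eq_one]
      linarith
  · refine hM 1 ((mem_spectrum_map_iff M _).2 ?_) (by simp)
    rw [h, hdet]
    norm_num

/-- The eigenvalue `(r - √D) / 2`. -/
def conjEigenvalue (M : GL (Fin 2) ℤ) : ℝ :=
  ((M.val.trace : ℝ) - Real.sqrt (discrim M : ℝ)) / 2

theorem IsHyperbolic.five_le_discrim {M : GL (Fin 2) ℤ} (hM : IsHyperbolic M)
    (hr : 0 < M.val.trace) : 5 ≤ discrim M := by
  unfold discrim
  rcases det_eq_or M with h | h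
  · have := hM.three_le_trace hr h
    rw [h]
    nlinarith
  · rw [h]
    nlinarith

theorem eigenvalue_sub (M : GL (Fin 2) ℤ) :
    eigenvalue M - conjEigenvalue M = Real.sqrt (discrim M : ℝ) := by
  unfold eigenvalue conjEigenvalue
  ring

theorem IsHyperbolic.isUnitPair {M : GL (Fin 2) ℤ} (hM : IsHyperbolic M)
    (hr : 0 < M.val.trace) :
    IsUnitPair M.val.trace M.val.det (eigenvalue M) (conjEigenvalue M) := by
  have hD : (5 : ℝ) ≤ discrim M := by exact_mod_cast hM.five_le_discrim hr
  have hsq : √(discrim M : ℝ) * √(discrim M : ℝ) = discrim M := Real.mul_self_sqrt (by linarith)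
  have hsqrt : 2 < √(discrim M : ℝ) := Real.lt_sqrt_of_sq_lt (by linarith)
  have hr' : (1 : ℝ) ≤ M.val.trace := by exact_mod_cast hr
  have hmul : eigenvalue M * conjEigenvalue M = M.val.det := by
    have : (discrim M : ℝ) = (M.val.trace : ℝ) ^ 2 - 4 * M.val.det := by
      simp [discrim]
    unfold eigenvalue conjEigenvalue
    linear_combination (-1 / 4 : ℝ) * hsq - (1 / 4 : ℝ) * this
  have hl : 1 < eigenvalue M := by
    unfold eigenvalue
    linarith
  refine ⟨det_eq_or M, ?_, hmul, hl, ?_⟩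
  · unfold eigenvalue conjEigenvalue
    ring
  · have h1 : |eigenvalue M * conjEigenvalue M| = 1 := by
      rw [hmul]
      rcases det_eq_or M with h | h <;> simp [h]
    rw [abs_mul, abs_of_pos (by linarith : 0 < eigenvalue M)] at h1
    nlinarith [abs_nonneg (conjEigenvalue M)]

theorem exists_isTile {M : GL (Fin 2) ℤ} (hM : IsHyperbolic M) (hr : 0 < M.val.trace) :
    ∃ R, IsTile (eigenvalue M) (conjEigenvalue M) R (compactum M) := by
  have h := hM.isUnitPair hr
  rcases det_eq_or M with hdet | hdet
  · have hX : compactum M = soficCompactum M.val.trace := by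
      ext e
      simp [compactum, hdet]
    rw [hX]
    rw [hdet] at h
    exact ⟨_, isTile_sofic h (hM.three_le_trace hr hdet)⟩
  · have hX : compactum M = markovCompactum M.val.trace := by
      ext e
      simp [compactum, hdet]
    rw [hX]
    rw [hdet] at h
    exact ⟨_, isTile_markov h⟩

/-! ### The torus -/

/-- Reduction modulo `ℤ²` as a homomorphism. -/
def toTorusHom : (Fin 2 → ℝ) →+ Torus where
  toFun := toTorus
  map_zero' := by
    funext i
    simp [toTorus]
  map_add' x y := by
    funext i
    simp [toTorus]

theorem continuous_toTorusHom : Continuous toTorusHom :=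
  continuous_pi fun i => (AddCircle.continuous_mk' 1).comp (continuous_apply i)

theorem toTorusHom_eq_iff (x y : Fin 2 → ℝ) :
    toTorusHom x = toTorusHom y ↔ ∃ z : Fin 2 → ℤ, x = y + fun i => (z i : ℝ) := by
  rw [← sub_eq_zero, ← map_sub]
  constructor
  · intro h
    have h1 : ∀ i, ∃ n : ℤ, x i - y i = n := fun i => by
      have h2 : ((x i - y i : ℝ) : UnitAddCircle) = 0 := congrFun h i
      obtain ⟨n, hn⟩ := (AddCircle.coe_eq_zero_iff 1).1 h2
      exact ⟨n, by simpa using hn.symm⟩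
    choose z hz using h1
    refine ⟨z, funext fun i => ?_⟩
    simp only [Pi.add_apply]
    linarith [hz i]
  · rintro ⟨z, rfl⟩
    funext i
    change (((y + fun i => (z i : ℝ)) - y) i : UnitAddCircle) = 0
    exact (AddCircle.coe_eq_zero_iff 1).2 ⟨z i, by simp⟩

theorem toTorusHom_intCast (z : Fin 2 → ℤ) : toTorusHom (fun i => (z i : ℝ)) = 0 := by
  rw [← map_zero toTorusHom, toTorusHom_eq_iff]
  exact ⟨z, by simp⟩

theorem act_toTorusHom (M : GL (Fin 2) ℤ) (x : Fin 2 → ℝ) :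
    act M (toTorusHom x) = toTorusHom fun i => ∑ j, (M.val i j : ℝ) * x j := by
  funext i
  change ∑ j, M.val i j • ((x j : ℝ) : UnitAddCircle)
    = ((∑ j, (M.val i j : ℝ) * x j : ℝ) : UnitAddCircle)
  simp [Fin.sum_univ_two, ← zsmul_eq_mul]

theorem act_mul (A B : GL (Fin 2) ℤ) (x : Torus) : act (A * B) x = act A (act B x) := by
  funext i
  change ∑ j, (A * B).val i j • x j = ∑ j, A.val i j • ∑ k, B.val j k • x k
  simp only [Units.val_mul, Matrix.mul_apply, Fin.sum_univ_two, add_smul, mul_smul, smul_add]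
  abel

theorem act_one (x : Torus) : act 1 x = x := by
  funext i
  change ∑ j, (1 : GL (Fin 2) ℤ).val i j • x j = x i
  fin_cases i <;> simp [Fin.sum_univ_two]

/-! ### Eigencoordinates -/

/-- The linear map `ℝ² → ℝ²` sending `(1, 1)` to `q` and `(l, m)` to `q'`. -/
def planeMap (l m : ℝ) (q q' : Fin 2 → ℤ) : ℝ × ℝ →ₗ[ℝ] (Fin 2 → ℝ) where
  toFun p := fun i => (l * p.2 - m * p.1) / (l - m) * q i + (p.1 - p.2) / (l - m) * q' i
  map_add' p p' := by
    funext i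
    simp only [Prod.fst_add, Prod.snd_add, Pi.add_apply]
    ring
  map_smul' c p := by
    funext i
    simp only [Prod.smul_fst, Prod.smul_snd, Pi.smul_apply, smul_eq_mul, RingHom.id_apply]
    ring

theorem planeMap_apply (l m : ℝ) (q q' : Fin 2 → ℤ) (p : ℝ × ℝ) (i : Fin 2) :
    planeMap l m q q' p i
      = (l * p.2 - m * p.1) / (l - m) * q i + (p.1 - p.2) / (l - m) * q' i := rfl

section Plane

variable {l m : ℝ} {r s : ℤ} {M : GL (Fin 2) ℤ} {q q' : Fin 2 → ℤ}

theorem IsUnitPair.sub_ne_zero (h : IsUnitPair r s l m) : l - m ≠ 0 := by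
  have h1 := h.one_lt
  have h2 := (_root_.abs_lt.1 h.abs_lt).2
  linarith

theorem planeMap_lattice (h : IsUnitPair r s l m) (i j : ℤ) :
    planeMap l m q q' (i + j * l, i + j * m) = fun k => ((i * q k + j * q' k : ℤ) : ℝ) := by
  funext k
  rw [planeMap_apply]
  have := h.sub_ne_zero
  push_cast
  field_simp
  ring

theorem mulVec_mulVec (M : GL (Fin 2) ℤ) (q : Fin 2 → ℤ) (i : Fin 2) :
    M.val.mulVec (M.val.mulVec q) i = M.val.trace * M.val.mulVec q i - M.val.det * q i := by
  fin_cases i <;>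
  · simp [Matrix.mulVec, dotProduct, Fin.sum_univ_two, Matrix.trace_fin_two, Matrix.det_fin_two]
    ring

/-- By Cayley–Hamilton, M acts on the pair q, Mq as multiplication by the root acts on 1 and the
root, hence diagonally in the two conjugate coordinates. -/
theorem act_planeMap (h : IsUnitPair M.val.trace M.val.det l m) (p : ℝ × ℝ) :
    act M (toTorusHom (planeMap l m q (M.val.mulVec q) p))
      = toTorusHom (planeMap l m q (M.val.mulVec q) (l * p.1, m * p.2)) := by
  rw [act_toTorusHom]
  congr 1
  have hne := h.sub_ne_zero
  funext i
  have h1 : ∑ j, (M.val i j : ℝ) * planeMap l m q (M.val.mulVec q) p j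
      = (l * p.2 - m * p.1) / (l - m) * M.val.mulVec q i
        + (p.1 - p.2) / (l - m) * M.val.mulVec (M.val.mulVec q) i := by
    simp only [planeMap_apply, Fin.sum_univ_two, Matrix.mulVec, dotProduct]
    push_cast
    ring
  have h2 : (M.val.mulVec (M.val.mulVec q) i : ℝ)
      = (l + m) * M.val.mulVec q i - l * m * q i := by
    rw [h.add, h.mul, mulVec_mulVec]
    push_cast
    ring
  rw [h1, h2, planeMap_apply]
  field_simp
  ring

theorem act_zpow_planeMap (h : IsUnitPair M.val.trace M.val.det l m) (p : ℝ × ℝ) (n : ℤ) :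
    act (M ^ n) (toTorusHom (planeMap l m q (M.val.mulVec q) p))
      = toTorusHom (planeMap l m q (M.val.mulVec q) (l ^ n * p.1, m ^ n * p.2)) := by
  induction n generalizing p with
  | zero => simp [act_one]
  | succ k ih =>
    rw [zpow_add_one, act_mul, act_planeMap h, ih, zpow_add_one₀ h.left_ne_zero,
      zpow_add_one₀ h.right_ne_zero, mul_assoc, mul_assoc]
  | pred k ih =>
    have h1 : act M⁻¹ (toTorusHom (planeMap l m q (M.val.mulVec q) p))
        = toTorusHom (planeMap l m q (M.val.mulVec q) (l⁻¹ * p.1, m⁻¹ * p.2)) := by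
      have h2 := act_planeMap (q := q) h (l⁻¹ * p.1, m⁻¹ * p.2)
      simp only [mul_inv_cancel_left₀ h.left_ne_zero, mul_inv_cancel_left₀ h.right_ne_zero,
        Prod.mk.eta] at h2
      rw [← h2, ← act_mul, inv_mul_cancel, act_one]
    rw [zpow_sub_one, act_mul, h1, ih, zpow_sub_one₀ h.left_ne_zero,
      zpow_sub_one₀ h.right_ne_zero, mul_assoc, mul_assoc]

theorem toTorusHom_planeMap_one_one (h : IsUnitPair r s l m) :
    toTorusHom (planeMap l m q q' (1, 1)) = 0 := by
  have := planeMap_lattice (q := q) (q' := q') h 1 0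
  simp only [Int.cast_one, Int.cast_zero, zero_mul, add_zero] at this
  rw [this]
  exact toTorusHom_intCast _

/-- The fundamental homoclinic point of the lattice spanned by `q` and `M q`. -/
def baseHomoclinic (M : GL (Fin 2) ℤ) (l m : ℝ) (q : Fin 2 → ℤ) : Torus :=
  toTorusHom (planeMap l m q (M.val.mulVec q) (1, 0))

theorem act_zpow_base (h : IsUnitPair M.val.trace M.val.det l m) (n : ℤ) :
    act (M ^ n) (baseHomoclinic M l m q)
      = toTorusHom (planeMap l m q (M.val.mulVec q) (l ^ n, 0)) := by
  rw [baseHomoclinic, act_zpow_planeMap h]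
  simp

/-- Subtracting (1, 1), which is trivial on the torus, replaces (1, 0) by (0, -1) on the contracting
axis; this is the source of the sign in `past`. -/
theorem act_zpow_base' (h : IsUnitPair M.val.trace M.val.det l m) (n : ℤ) :
    act (M ^ n) (baseHomoclinic M l m q)
      = toTorusHom (planeMap l m q (M.val.mulVec q) (0, -m ^ n)) := by
  have h1 : baseHomoclinic M l m q
      = toTorusHom (planeMap l m q (M.val.mulVec q) (0, -1)) := by
    rw [← add_zero (toTorusHom (planeMap l m q (M.val.mulVec q) (0, -1))),
      ← toTorusHom_planeMap_one_one (q := q) (q' := M.val.mulVec q) h, ← map_add, ← map_add]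
    simp [baseHomoclinic]
  rw [h1, act_zpow_planeMap h]
  simp

theorem continuous_toTorusHom_planeMap :
    Continuous fun p => toTorusHom (planeMap l m q q' p) :=
  continuous_toTorusHom.comp (planeMap l m q q').continuous_of_finiteDimensional

theorem tendsto_zpow_atTop_zero {a : ℝ} (ha : |a| < 1) :
    Tendsto (fun n : ℤ => a ^ n) atTop (𝓝 0) := by
  rw [← Nat.map_cast_int_atTop, tendsto_map'_iff]
  simpa [Function.comp_def] using tendsto_pow_atTop_nhds_zero_of_abs_lt_one ha

theorem isHomoclinic_base (h : IsUnitPair M.val.trace M.val.det l m) :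
    IsHomoclinic M (baseHomoclinic M l m q) := by
  have hc := (continuous_toTorusHom_planeMap (l := l) (m := m) (q := q)
    (q' := M.val.mulVec q)).tendsto (0, 0)
  rw [Prod.mk_zero_zero, map_zero, map_zero] at hc
  constructor
  · simp only [act_zpow_base' h]
    refine hc.comp (Tendsto.prodMk_nhds tendsto_const_nhds ?_)
    simpa using (tendsto_zpow_atTop_zero h.abs_lt).neg
  · simp only [act_zpow_base h]
    refine hc.comp (Tendsto.prodMk_nhds ?_ tendsto_const_nhds)
    have := (tendsto_zpow_atTop_zero (abs_inv_lt_one h.one_lt)).comp tendsto_neg_atBot_atTop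
    simpa [Function.comp_def] using this

theorem sum_Icc_neg_succ {A : Type*} [AddCommGroup A] (f : ℤ → A) (N : ℕ) :
    ∑ n ∈ Finset.Icc (-((N + 1 : ℕ) : ℤ)) ((N + 1 : ℕ) : ℤ), f n
      = ∑ n ∈ Finset.Icc (-(N : ℤ)) (N : ℤ), f n + f (N + 1) + f (-1 - N) := by
  have : Finset.Icc (-((N + 1 : ℕ) : ℤ)) ((N + 1 : ℕ) : ℤ)
      = insert (-1 - N : ℤ) (insert (N + 1 : ℤ) (Finset.Icc (-(N : ℤ)) (N : ℤ))) := by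
    ext n
    simp only [Finset.mem_Icc, Finset.mem_insert]
    omega
  rw [this, Finset.sum_insert (by simp; omega), Finset.sum_insert (by simp)]
  abel

/-- Terms with n ≥ 0 use the expanding representative and the others the contracting one. The index
0 belongs to the first sum, hence N + 1 terms against N. -/
theorem partialSum_base (h : IsUnitPair M.val.trace M.val.det l m) (e : ℤ → ℕ) (N : ℕ) :
    partialSum M (baseHomoclinic M l m q) e N
      = toTorusHom (planeMap l m q (M.val.mulVec q)
        (∑ k ∈ Finset.range (N + 1), (e (0 + (k : ℤ)) : ℝ) * l⁻¹ ^ k,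
          -(m * ∑ k ∈ Finset.range N, (e (0 - 1 - (k : ℤ)) : ℝ) * m ^ k))) := by
  induction N with
  | zero =>
    simp only [partialSum, Nat.cast_zero, neg_zero, Finset.Icc_self, Finset.sum_singleton]
    rw [act_zpow_base h, ← map_nsmul, ← map_nsmul, Prod.smul_mk]
    simp
  | succ N ih =>
    unfold partialSum at ih ⊢
    rw [sum_Icc_neg_succ, ih, act_zpow_base h, act_zpow_base' h, ← map_nsmul, ← map_nsmul,
      ← map_nsmul, ← map_nsmul, ← map_add, ← map_add, ← map_add, ← map_add]
    rw [Prod.smul_mk, Prod.smul_mk, Prod.mk_add_mk, Prod.mk_add_mk,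
      Finset.sum_range_succ _ (N + 1)]
    simp only [smul_zero, nsmul_eq_mul, add_zero]
    congr 3
    · have hpow : l⁻¹ ^ (N + 1) = l ^ (-((N : ℤ) + 1)) := by
        rw [← zpow_natCast, inv_zpow']
        push_cast
        rfl
      rw [hpow, zero_add]
      push_cast
      ring
    · rw [show -(-1 - (N : ℤ)) = ((N + 1 : ℕ) : ℤ) by push_cast; ring, zpow_natCast, zero_sub,
        Finset.sum_range_succ]
      ring

theorem tendsto_partialSum_base (h : IsUnitPair M.val.trace M.val.det l m) {e : ℤ → ℕ} {B : ℕ}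
    (he : ∀ n, e n ≤ B) :
    Tendsto (partialSum M (baseHomoclinic M l m q) e) atTop
      (𝓝 (toTorusHom (planeMap l m q (M.val.mulVec q) (future l e 0, past m e 0)))) := by
  simp only [funext (partialSum_base (q := q) h e)]
  refine (continuous_toTorusHom_planeMap.tendsto _).comp (Tendsto.prodMk_nhds ?_ ?_)
  · exact ((summable_digits (abs_inv_lt_one h.one_lt)
      fun k => he (0 + (k : ℕ))).hasSum.tendsto_sum_nat).comp (tendsto_add_atTop_nat 1)
  · exact ((summable_digits h.abs_lt
      fun k => he (0 - 1 - (k : ℕ))).hasSum.tendsto_sum_nat.const_mul m).neg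

/-- With w = (v, u) and q = -σMw, Cayley–Hamilton and σ² = 1 give Mq = rq + w. Hence (Mq - mq)/(l -
m) = (w + lq)/√D, which identifies **t** as the image of (1, 0). -/
theorem mulVec_latticeVector (M : GL (Fin 2) ℤ) (u v : ℤ) (i : Fin 2) :
    M.val.mulVec (latticeVector M u v) i = M.val.trace * latticeVector M u v i + ![v, u] i := by
  have hs : M.val.det * M.val.det = 1 := by rcases det_eq_or M with h | h <;> simp [h]
  have hd := Matrix.det_fin_two M.val
  fin_cases i
  · simp [latticeVector, Matrix.mulVec, dotProduct, Fin.sum_univ_two, Matrix.trace_fin_two]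
    linear_combination v * hs - v * M.val.det * hd
  · simp [latticeVector, Matrix.mulVec, dotProduct, Fin.sum_univ_two, Matrix.trace_fin_two]
    linear_combination u * hs - u * M.val.det * hd

theorem homoclinicPoint_eq_base {M : GL (Fin 2) ℤ} (hM : IsHyperbolic M)
    (hr : 0 < M.val.trace) (u v : ℤ) :
    homoclinicPoint M u v
      = baseHomoclinic M (eigenvalue M) (conjEigenvalue M) (latticeVector M u v) := by
  have hadd := (hM.isUnitPair hr).add
  unfold homoclinicPoint baseHomoclinic
  change toTorusHom _ = _
  congr 1
  funext i
  rw [planeMap_apply, mulVec_latticeVector, eigenvalue_sub]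
  push_cast
  rw [← hadd]
  fin_cases i
  · simp
    ring
  · simp
    ring

end Plane

/-! ### Null sets -/

theorem quasiMeasurePreserving_lift :
    Measure.QuasiMeasurePreserving
      (fun (x : Torus) (i : Fin 2) => ((AddCircle.equivIoc (1 : ℝ) 0 (x i) : ℝ))) := by
  have h1 : MeasurePreserving (fun x : UnitAddCircle => ((AddCircle.equivIoc (1 : ℝ) 0 x : ℝ)))
      volume (volume.restrict (Set.Ioc (0 : ℝ) (0 + 1))) :=
    (measurePreserving_subtype_coe measurableSet_Ioc).comp
      (AddCircle.measurePreserving_equivIoc (1 : ℝ) (a := 0))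
  have h2 := measurePreserving_pi (fun _ : Fin 2 => (volume : Measure UnitAddCircle))
    (fun _ => volume.restrict (Set.Ioc (0 : ℝ) (0 + 1))) (fun _ => h1)
  rw [← Measure.restrict_pi_pi] at h2
  exact h2.quasiMeasurePreserving.mono_right Measure.absolutelyContinuous_restrict

theorem toTorusHom_lift (x : Torus) :
    toTorusHom (fun i => ((AddCircle.equivIoc (1 : ℝ) 0 (x i) : ℝ))) = x :=
  funext fun i => (AddCircle.equivIoc (1 : ℝ) 0).symm_apply_apply (x i)

theorem ae_linear_ne {f : (Fin 2 → ℝ) →ₗ[ℝ] ℝ} (hf : f ≠ 0) (c : ℝ) :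
    ∀ᵐ x : Fin 2 → ℝ, f x ≠ c := by
  by_cases hc : ∃ x₀, f x₀ = c
  · obtain ⟨x₀, rfl⟩ := hc
    have h1 := Measure.addHaar_affineSubspace (volume : Measure (Fin 2 → ℝ))
      (AffineSubspace.mk' x₀ (LinearMap.ker f)) (fun h => hf ?_)
    · refine measure_mono_null (fun x hx => ?_) h1
      simpa [sub_eq_zero] using hx
    · have := congrArg AffineSubspace.direction h
      rw [AffineSubspace.direction_mk', AffineSubspace.direction_top] at this
      exact LinearMap.ker_eq_top.1 this
  · exact Eventually.of_forall fun x hx => hc ⟨x, hx⟩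

/-- All lifts of a point differ from one measurable lift by integer vectors, so only countably many
level sets of `f`, each null, have to be avoided. -/
theorem ae_forall_lift_notMem {f : (Fin 2 → ℝ) →ₗ[ℝ] ℝ} (hf : f ≠ 0) {C : Set ℝ}
    (hC : C.Countable) : ∀ᵐ x : Torus, ∀ y, toTorusHom y = x → f y ∉ C := by
  have h1 : ∀ᵐ y : Fin 2 → ℝ, ∀ z : Fin 2 → ℤ, ∀ c ∈ C, f y ≠ c - f (fun i => (z i : ℝ)) := by
    rw [ae_all_iff]
    intro z
    rw [ae_ball_iff hC]
    exact fun c _ => ae_linear_ne hf _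
  filter_upwards [quasiMeasurePreserving_lift.ae h1] with x hx y hy hyC
  obtain ⟨z, rfl⟩ := (toTorusHom_eq_iff _ _).1 (hy.trans (toTorusHom_lift x).symm)
  refine hx z _ hyC ?_
  rw [map_add, add_sub_cancel_right]

theorem countable_inModule (l : ℝ) : {a | InModule l a}.Countable := by
  refine (Set.countable_range fun p : ℤ × ℤ => (p.1 + p.2 * l : ℝ)).mono ?_
  rintro a ⟨i, j, rfl⟩
  exact ⟨(i, j), rfl⟩

/-! ### The index of the lattice -/

/-- The subgroup of `ℤ²` generated by `q` and `q'`. -/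
def pairLattice (q q' : Fin 2 → ℤ) : Submodule ℤ (Fin 2 → ℤ) :=
  LinearMap.range (Matrix.toLin' !![q 0, q' 0; q 1, q' 1])

theorem mem_pairLattice (q q' z : Fin 2 → ℤ) :
    z ∈ pairLattice q q' ↔ ∃ i j : ℤ, ∀ k, z k = i * q k + j * q' k := by
  constructor
  · rintro ⟨w, rfl⟩
    refine ⟨w 0, w 1, fun k => ?_⟩
    fin_cases k <;> simp [Matrix.mulVec, dotProduct, Fin.sum_univ_two] <;> ring
  · rintro ⟨i, j, h⟩
    refine ⟨![i, j], funext fun k => ?_⟩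
    rw [h k]
    fin_cases k <;> simp [Matrix.mulVec, dotProduct, Fin.sum_univ_two] <;> ring

theorem card_quotient_pairLattice {q q' : Fin 2 → ℤ} (h : q 0 * q' 1 - q 1 * q' 0 ≠ 0) :
    Nat.card ((Fin 2 → ℤ) ⧸ pairLattice q q') = (q 0 * q' 1 - q 1 * q' 0).natAbs := by
  have hdet : (!![q 0, q' 0; q 1, q' 1] : Matrix (Fin 2) (Fin 2) ℤ).det
      = q 0 * q' 1 - q 1 * q' 0 := by
    rw [Matrix.det_fin_two_of]
    ring
  have hinj : Function.Injective (Matrix.toLin' !![q 0, q' 0; q 1, q' 1]) :=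
    Matrix.mulVec_injective_of_det_ne_zero (by rwa [hdet])
  rw [pairLattice, ← Submodule.natAbs_det_equiv _ (LinearEquiv.ofInjective _ hinj), ← hdet,
    ← LinearMap.det_toLin']
  rfl

/-- Up to sign, w ∧ Mw for w = (v, u) is the form at (u, -v), and replacing w by -σMw multiplies
this determinant by det M = ±1. -/
theorem natAbs_assocForm (M : GL (Fin 2) ℤ) (u v : ℤ) :
    (assocForm M u (-v)).natAbs
      = (latticeVector M u v 0 * M.val.mulVec (latticeVector M u v) 1
        - latticeVector M u v 1 * M.val.mulVec (latticeVector M u v) 0).natAbs := by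
  have hd := Matrix.det_fin_two M.val
  have key : latticeVector M u v 0 * M.val.mulVec (latticeVector M u v) 1
        - latticeVector M u v 1 * M.val.mulVec (latticeVector M u v) 0
      = -(M.val.det ^ 2 * M.val.det * assocForm M u (-v)) := by
    simp [latticeVector, assocForm, Matrix.mulVec, dotProduct, Fin.sum_univ_two]
    rw [hd]
    ring
  rw [key, Int.natAbs_neg, Int.natAbs_mul]
  rcases det_eq_or M with h | h <;> simp [h]

/-! ### Fibres of the coding -/

section Fibre

variable {l m : ℝ} {r s : ℤ} {q q' : Fin 2 → ℤ} {R : Set (ℝ × ℝ)} {X : Set (ℤ → ℕ)}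

theorem planeMap_injective (h : IsUnitPair r s l m) (hq : q 0 * q' 1 - q 1 * q' 0 ≠ 0) :
    Function.Injective (planeMap l m q q') := by
  rw [injective_iff_map_eq_zero]
  intro p hp
  have hne := h.sub_ne_zero
  have hq' : (q 0 * q' 1 - q 1 * q' 0 : ℝ) ≠ 0 := by exact_mod_cast hq
  have h0 := congrFun hp 0
  have h1 := congrFun hp 1
  rw [planeMap_apply, Pi.zero_apply] at h0 h1
  have hs : (l * p.2 - m * p.1) / (l - m) = 0 := by
    refine (mul_eq_zero_iff_right hq').1 ?_
    linear_combination (q' 1 : ℝ) * h0 - (q' 0 : ℝ) * h1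
  have ht : (p.1 - p.2) / (l - m) = 0 := by
    refine (mul_eq_zero_iff_right hq').1 ?_
    linear_combination (q 0 : ℝ) * h1 - (q 1 : ℝ) * h0
  rw [div_eq_zero_iff, or_iff_left hne] at hs ht
  have h2 : p.1 = p.2 := sub_eq_zero.1 ht
  rw [h2, ← sub_mul, mul_eq_zero, or_iff_right hne] at hs
  exact Prod.ext (h2.trans hs) hs

/-- The eigencoordinates as a linear equivalence. -/
def planeEquiv (h : IsUnitPair r s l m) (hq : q 0 * q' 1 - q 1 * q' 0 ≠ 0) :
    (ℝ × ℝ) ≃ₗ[ℝ] (Fin 2 → ℝ) :=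
  LinearMap.linearEquivOfInjective (planeMap l m q q') (planeMap_injective h hq) (by simp)

theorem planeEquiv_apply (h : IsUnitPair r s l m) (hq : q 0 * q' 1 - q 1 * q' 0 ≠ 0)
    (p : ℝ × ℝ) : planeEquiv h hq p = planeMap l m q q' p := rfl

theorem ae_isGeneric (h : IsUnitPair r s l m) (hq : q 0 * q' 1 - q 1 * q' 0 ≠ 0) :
    ∀ᵐ x : Torus, ∀ p, toTorusHom (planeMap l m q q' p) = x → IsGeneric l m p := by
  have h1 : LinearMap.fst ℝ ℝ ℝ ∘ₗ (planeEquiv h hq).symm.toLinearMap ≠ 0 := fun hc => by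
    simpa using LinearMap.congr_fun hc (planeEquiv h hq (1, 0))
  have h2 : LinearMap.snd ℝ ℝ ℝ ∘ₗ (planeEquiv h hq).symm.toLinearMap ≠ 0 := fun hc => by
    simpa using LinearMap.congr_fun hc (planeEquiv h hq (0, 1))
  filter_upwards [ae_forall_lift_notMem h1 (countable_inModule l),
    ae_forall_lift_notMem h2 (countable_inModule m)] with x hx1 hx2 p hp
  have hx1 := hx1 _ hp
  have hx2 := hx2 _ hp
  rw [← planeEquiv_apply h hq] at hx1 hx2
  exact ⟨by simpa using hx1, by simpa using hx2⟩

theorem encard_fibre (h : IsUnitPair r s l m) (hq : q 0 * q' 1 - q 1 * q' 0 ≠ 0)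
    (hT : IsTile l m R X) {x : Torus}
    (hx : ∀ p, toTorusHom (planeMap l m q q' p) = x → IsGeneric l m p) :
    {e ∈ X | toTorusHom (planeMap l m q q' (future l e 0, past m e 0)) = x}.encard
      = ((q 0 * q' 1 - q 1 * q' 0).natAbs : ℕ∞) := by
  obtain ⟨y, rfl⟩ : ∃ y, toTorusHom y = x := ⟨_, toTorusHom_lift x⟩
  set P := planeEquiv h hq
  have hPa : ∀ p, planeMap l m q q' p = P p := fun p => rfl
  set lift : (Fin 2 → ℤ) → Fin 2 → ℝ := fun z => y + fun i => (z i : ℝ) with hlift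
  have hgen : ∀ z, IsGeneric l m (P.symm (lift z)) := fun z => hx _ (by
    rw [hPa, P.apply_symm_apply, toTorusHom_eq_iff]
    exact ⟨z, rfl⟩)
  -- Cosets of Λ among the lifts of the torus point correspond to classes of ℤ² modulo ℤq + ℤq'.
  have hL : ∀ (e : ℤ → ℕ) (z z' : Fin 2 → ℤ), P (future l e 0, past m e 0) = lift z →
      (InLattice l m (future l e 0 - (P.symm (lift z')).1) (past m e 0 - (P.symm (lift z')).2) ↔
        z - z' ∈ pairLattice q q') := by
    intro e z z' he
    have h1 : (future l e 0 - (P.symm (lift z')).1, past m e 0 - (P.symm (lift z')).2)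
        = P.symm (fun i => ((z - z') i : ℝ)) := by
      have : (fun i => (((z - z') i : ℤ) : ℝ)) = lift z - lift z' := by
        funext i
        simp [hlift]
      rw [this, map_sub, ← he, P.symm_apply_apply]
      rfl
    have h2 : InLattice l m (future l e 0 - (P.symm (lift z')).1)
        (past m e 0 - (P.symm (lift z')).2) ↔
        ∃ i j : ℤ, (future l e 0 - (P.symm (lift z')).1, past m e 0 - (P.symm (lift z')).2)
          = ((i + j * l, i + j * m) : ℝ × ℝ) := by
      simp only [Prod.mk.injEq, InLattice]
    rw [h2, h1, mem_pairLattice]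
    refine exists_congr fun i => exists_congr fun j => ?_
    rw [LinearEquiv.symm_apply_eq, ← hPa, planeMap_lattice h, funext_iff]
    exact forall_congr' fun k => by exact_mod_cast Iff.rfl
  have hex : ∀ z : Fin 2 → ℤ, ∃ e ∈ X, ∃ z', P (future l e 0, past m e 0) = lift z' ∧
      z' - z ∈ pairLattice q q' := by
    intro z
    obtain ⟨e, heX, he⟩ := hT.exists_code h (hgen z)
    obtain ⟨i, j, hi, hj⟩ := he
    have h1 : P (future l e 0, past m e 0) = lift (z + fun k => i * q k + j * q' k) := by
      have h2 : ((future l e 0, past m e 0) : ℝ × ℝ)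
          = P.symm (lift z) + ((i + j * l, i + j * m) : ℝ × ℝ) :=
        Prod.ext (sub_eq_iff_eq_add'.1 hi) (sub_eq_iff_eq_add'.1 hj)
      rw [h2, map_add, P.apply_symm_apply, ← hPa, planeMap_lattice h]
      funext k
      simp [hlift]
      ring
    exact ⟨e, heX, _, h1, (hL e _ z h1).1 ⟨i, j, hi, hj⟩⟩
  choose g hgX gz hgP hgL using hex
  -- The fibre is parametrized by classes: existence of codes selects one for each class, and
  -- uniqueness shows that no others occur.
  have hrange : {e ∈ X | toTorusHom (planeMap l m q q' (future l e 0, past m e 0))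
      = toTorusHom y} = Set.range fun c : (Fin 2 → ℤ) ⧸ pairLattice q q' => g c.out := by
    ext e
    constructor
    · rintro ⟨heX, he⟩
      obtain ⟨z, hz⟩ := (toTorusHom_eq_iff _ _).1 he
      refine ⟨Submodule.Quotient.mk z, ?_⟩
      have h1 : z - (Submodule.Quotient.mk z : (Fin 2 → ℤ) ⧸ pairLattice q q').out
          ∈ pairLattice q q' := by
        rw [← Submodule.Quotient.eq]
        exact (Quotient.out_eq _).symm
      exact hT.code_unique h (hgen _) (hgX _) heX ((hL _ _ _ (hgP _)).2 (hgL _))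
        ((hL _ _ _ hz).2 h1)
    · rintro ⟨c, rfl⟩
      refine ⟨hgX _, ?_⟩
      rw [hPa, hgP, toTorusHom_eq_iff]
      exact ⟨_, rfl⟩
  have hinj : Function.Injective fun c : (Fin 2 → ℤ) ⧸ pairLattice q q' => g c.out := by
    intro c c' hcc
    have h1 := hgP c.out
    have h2 := hgP c'.out
    simp only at hcc
    rw [hcc] at h1
    have h3 := (hL _ _ c.out h1).2 (hgL _)
    have h4 := (hL _ _ c.out h2).1 h3
    have h5 := sub_mem h4 (hgL c'.out)
    rw [sub_sub_sub_cancel_left, ← Submodule.Quotient.eq] at h5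
    have h6 : c' = c := by
      have e1 : Submodule.Quotient.mk c.out = c := Quotient.out_eq c
      have e2 : Submodule.Quotient.mk c'.out = c' := Quotient.out_eq c'
      rw [← e1, ← e2, h5]
    exact h6.symm
  have hcard := card_quotient_pairLattice hq
  have hfin : Finite ((Fin 2 → ℤ) ⧸ pairLattice q q') :=
    Nat.finite_of_card_ne_zero (by rw [hcard]; exact Int.natAbs_ne_zero.2 hq)
  rw [hrange, ← Set.image_univ, hinj.encard_image, Set.encard_univ,
    ENat.card_eq_coe_natCard, hcard]

/-- Dependent `q` and `q'` are both killed by a nonzero functional, so the image of the plane lies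
in its kernel, which is null modulo ℤ². -/
theorem ae_notMem_range (hq : q 0 * q' 1 - q 1 * q' 0 = 0) :
    ∀ᵐ x : Torus, ∀ p, toTorusHom (planeMap l m q q' p) ≠ x := by
  have hdet : (!![(q 0 : ℝ), q 1; q' 0, q' 1] : Matrix (Fin 2) (Fin 2) ℝ).det = 0 := by
    rw [Matrix.det_fin_two_of]
    exact_mod_cast hq
  obtain ⟨w, hw, hw0⟩ := Matrix.exists_mulVec_eq_zero_iff.2 hdet
  have h0 := congrFun hw0 0
  have h1 := congrFun hw0 1
  simp [Matrix.mulVec, dotProduct, Fin.sum_univ_two] at h0 h1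
  have hf : w 0 • LinearMap.proj (R := ℝ) (φ := fun _ : Fin 2 => ℝ) 0
      + w 1 • LinearMap.proj (R := ℝ) (φ := fun _ : Fin 2 => ℝ) 1 ≠ 0 := fun hc => hw (by
    funext i
    fin_cases i
    · simpa using LinearMap.congr_fun hc ![1, 0]
    · simpa using LinearMap.congr_fun hc ![0, 1])
  filter_upwards [ae_forall_lift_notMem hf (Set.countable_singleton 0)] with x hx p hp
  refine hx _ hp ?_
  simp only [LinearMap.add_apply, LinearMap.smul_apply, LinearMap.proj_apply, smul_eq_mul,
    planeMap_apply, Set.mem_singleton_iff]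
  linear_combination (l * p.2 - m * p.1) / (l - m) * h0 + (p.1 - p.2) / (l - m) * h1

end Fibre

end ToralCoding

end

theorem theorem3p1 (M : GL (Fin 2) ℤ) (hM : ToralCoding.IsHyperbolic M)
    (hr : 0 < M.val.trace) (u v : ℤ) :
    ToralCoding.IsHomoclinic M (ToralCoding.homoclinicPoint M u v) ∧
    (∀ e ∈ ToralCoding.compactum M,
      Tendsto (ToralCoding.partialSum M (ToralCoding.homoclinicPoint M u v) e) atTop
        (𝓝 (ToralCoding.coding M (ToralCoding.homoclinicPoint M u v) e))) ∧
    ∀ᵐ x : ToralCoding.Torus,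
      {e ∈ ToralCoding.compactum M |
        ToralCoding.coding M (ToralCoding.homoclinicPoint M u v) e = x}.encard
          = ((ToralCoding.assocForm M u (-v)).natAbs : ℕ∞) := by
  open ToralCoding in
  have h := hM.isUnitPair hr
  obtain ⟨R, hT⟩ := exists_isTile hM hr
  obtain ⟨B, hB⟩ := hT.digits
  rw [homoclinicPoint_eq_base hM hr, natAbs_assocForm]
  set q := latticeVector M u v
  have hlim : ∀ e ∈ compactum M, Tendsto (partialSum M
      (baseHomoclinic M (eigenvalue M) (conjEigenvalue M) q) e) atTop
      (𝓝 (toTorusHom (planeMap (eigenvalue M) (conjEigenvalue M) q (M.val.mulVec q)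
        (future (eigenvalue M) e 0, past (conjEigenvalue M) e 0)))) := fun e he =>
    tendsto_partialSum_base h (hB e he)
  have hcoding : ∀ e ∈ compactum M,
      coding M (baseHomoclinic M (eigenvalue M) (conjEigenvalue M) q) e
        = toTorusHom (planeMap (eigenvalue M) (conjEigenvalue M) q (M.val.mulVec q)
          (future (eigenvalue M) e 0, past (conjEigenvalue M) e 0)) := fun e he =>
    (hlim e he).limUnder_eq
  refine ⟨isHomoclinic_base h, fun e he => by rw [hcoding e he]; exact hlim e he, ?_⟩
  have hset : ∀ x, {e ∈ compactum M |
      coding M (baseHomoclinic M (eigenvalue M) (conjEigenvalue M) q) e = x}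
      = {e ∈ compactum M | toTorusHom (planeMap (eigenvalue M) (conjEigenvalue M) q
        (M.val.mulVec q) (future (eigenvalue M) e 0, past (conjEigenvalue M) e 0)) = x} := by
    intro x
    ext e
    exact and_congr_right fun he => by rw [hcoding e he]
  simp only [hset]
  by_cases hq : q 0 * M.val.mulVec q 1 - q 1 * M.val.mulVec q 0 = 0
  · filter_upwards [ae_notMem_range (l := eigenvalue M) (m := conjEigenvalue M) hq] with x hx
    rw [hq, Int.natAbs_zero, Nat.cast_zero, Set.encard_eq_zero]
    exact Set.eq_empty_of_forall_notMem fun e he => hx _ he.2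
  · filter_upwards [ae_isGeneric h hq] with x hx
    exact encard_fibre h hq hT hx
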